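/- Write $i=\sqrt{-1}$ and let $$X=\{u(1+i)+v(1-i) : -\tfrac12\le u,v<\tfrac12\}\subset\mathbb{C},$$ with interior $X^o$ and closure $\overline X$. **Floor function.** For $0\le k<4$ put $L(i^k(1+i))=\{i^k(1+i)m : m\in\mathbb{Z}_{>0}\}$ and $L(i^k2)=\{i^k(m(1+i)+l(1-i)) : m,l\in\mathbb{Z}_{>0}\}$; these sets partition $(1+i)\mathbb{Z}[i]\setminus\{0\}$. Let $Q_0=\overline X$. For $w\in L(i^k(1+i))$ let $Q_w$ be the union of $X^o+w$ and of the three edges $\{ui^k(1+i)-\tfrac12 i^k(1-i)+w : -\tfrac12<u\le\tfrac12\}$, $\{\tfrac12 i^k(1+i)+ui^k(1-i)+w : -\tfrac12\le u\le\tfrac12\}$, $\{ui^k(1+i)+\tfrac12 i^k(1-i)+w : -\tfrac12<u\le\tfrac12\}$. For $w\in L(i^k2)$ let $Q_w$ be the union of $X^o+w$ and of the two edges $\{ui^k(1+i)+\tfrac12 i^k(1-i)+w : -\tfrac12<u\le\tfrac12\}$, $\{\tfrac12 i^k(1+i)+ui^k(1-i)+w : -\tfrac12<u\le\tfrac12\}$.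 For $z\in\mathbb{C}\setminus\mathbb{Z}[i]$ let $\lfloor z\rfloor_H$ be the unique $w\in(1+i)\mathbb{Z}[i]$ with $z\in Q_w$; for $z\in\mathbb{Z}[i]$ let $\lfloor z\rfloor_H=z$. **J. Hurwitz orbit.** For $z\in\overline X$ let $T_H(z)=\frac1z-\lfloor\frac1z\rfloor_H$ if $z\neq0$, and $T_H(0)=0$. The orbit of $\alpha\in\overline X$ is $\alpha^H_{(1)}=\alpha$, $\alpha^H_{(n+1)}=T_H(\alpha^H_{(n)})$ as long as $\alpha^H_{(n)}\ne0$; it terminates if $\alpha^H_{(n)}=0$. It is called purely periodic if it does not terminate and there is $m\ge1$ with $\alpha^H_{(n+m)}=\alpha^H_{(n)}$ for all $n\ge1$. **The domain $\widetilde X$.** For $1\le j\le4$ let $$X_j=\{z\in X : |z-i^{k+j-1}(1+i)/2|>\tfrac{\sqrt2}2\ \text{for } k=0,1,2\},$$ $$X_{j+4}=\{z\in X : |z-i^{k+j-1}(1-i)/2|<\tfrac{\sqrt2}2\ \text{for } k=0,1\},$$ $$W_j=\{z\in\mathbb{C} : |z|>1,\ |z-i^{j-1}(1-i)|\ge1\},$$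 $$W_{j+4}=\{z\in\mathbb{C} : |z|>1,\ |z-i^{k+j-1}(1-i)|\ge1\ \text{for } k=0,1\},$$ and let $$\widetilde X=\bigcup_{1\le j\le4}\overline{X_j}\times(W_j\cup\{\infty\})\ \cup\bigcup_{5\le j\le8}X_j\times(W_j\cup\{\infty\}).$$ **Theorem.** Let $\alpha\in\overline X$. The orbit $\alpha^H_{(1)}=\alpha,\alpha^H_{(2)},\alpha^H_{(3)},\ldots$ is purely periodic if and only if $\alpha$ is a quadratic irrational over $\mathbb{Q}(i)$ (algebraic of degree exactly $2$ over $\mathbb{Q}(i)$) and $(\alpha,\alpha')\in\widetilde X$, where $\alpha'$ is the Galois conjugate of $\alpha$ over $\mathbb{Q}(i)$, i.e. the other root of its minimal polynomial over $\mathbb{Q}(i)$. -/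

import Mathlib

noncomputable section

namespace JHurwitz

open Complex

/-- The half-open square `X = {u(1+i) + v(1-i) : -1/2 ≤ u, v < 1/2}`. -/
def X : Set ℂ :=
  {z | ∃ u v : ℝ, -(1 / 2) ≤ u ∧ u < 1 / 2 ∧ -(1 / 2) ≤ v ∧ v < 1 / 2 ∧
    z = u * (1 + I) + v * (1 - I)}

/-- The Gaussian integers `ℤ[i]`, as a subset of `ℂ`. -/
def gaussInt : Set ℂ := Set.range GaussianInt.toComplex

/-- The ideal `(1+i)ℤ[i]`, as a subset of `ℂ`. -/
def evenGauss : Set ℂ := {w | ∃ g ∈ gaussInt, w = (1 + I) * g}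

/-- The ray `L(i^k(1+i)) = i^k(1+i)ℤ_{>0}`. -/
def rayL (k : ℕ) : Set ℂ := {w | ∃ m : ℤ, 0 < m ∧ w = I ^ k * (1 + I) * m}

/-- The open sector `L(i^k 2) = {i^k(m(1+i) + l(1-i)) : m, l ∈ ℤ_{>0}}`. -/
def sectorL (k : ℕ) : Set ℂ :=
  {w | ∃ m l : ℤ, 0 < m ∧ 0 < l ∧ w = I ^ k * (m * (1 + I) + l * (1 - I))}

/-- The part of the boundary of the square centred at `0` that belongs to the tile
`Q_w - w` when `w ∈ L(i^k(1+i))`: three of the four edges. -/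
def rayEdges (k : ℕ) : Set ℂ :=
  {z | ∃ u : ℝ, -(1 / 2) < u ∧ u ≤ 1 / 2 ∧
      z = u * I ^ k * (1 + I) - 1 / 2 * I ^ k * (1 - I)} ∪
  {z | ∃ u : ℝ, -(1 / 2) ≤ u ∧ u ≤ 1 / 2 ∧
      z = 1 / 2 * I ^ k * (1 + I) + u * I ^ k * (1 - I)} ∪
  {z | ∃ u : ℝ, -(1 / 2) < u ∧ u ≤ 1 / 2 ∧
      z = u * I ^ k * (1 + I) + 1 / 2 * I ^ k * (1 - I)}

/-- The part of the boundary of the square centred at `0` that belongs to the tile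
`Q_w - w` when `w ∈ L(i^k 2)`: two of the four edges. -/
def sectorEdges (k : ℕ) : Set ℂ :=
  {z | ∃ u : ℝ, -(1 / 2) < u ∧ u ≤ 1 / 2 ∧
      z = u * I ^ k * (1 + I) + 1 / 2 * I ^ k * (1 - I)} ∪
  {z | ∃ u : ℝ, -(1 / 2) < u ∧ u ≤ 1 / 2 ∧
      z = 1 / 2 * I ^ k * (1 + I) + u * I ^ k * (1 - I)}

/-- The tile `Q_w`, for `w ∈ (1+i)ℤ[i]`. -/
def Q (w : ℂ) : Set ℂ :=
  {z | (w = 0 ∧ z ∈ closure X) ∨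
    (∃ k < 4, w ∈ rayL k ∧ z - w ∈ interior X ∪ rayEdges k) ∨
    (∃ k < 4, w ∈ sectorL k ∧ z - w ∈ interior X ∪ sectorEdges k)}

open Classical in
/-- The floor function `⌊z⌋_H`: it is `z` itself when `z ∈ ℤ[i]`, and otherwise the unique
`w ∈ (1+i)ℤ[i]` whose tile `Q_w` contains `z`. -/
def floorH (z : ℂ) : ℂ :=
  if z ∈ gaussInt then z else Classical.epsilon fun w => w ∈ evenGauss ∧ z ∈ Q w

open Classical in
/-- The transformation `T_H` (used on the closure of `X`). -/
def TH (z : ℂ) : ℂ := if z = 0 then 0 else 1 / z - floorH (1 / z)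

/-- The orbit `α_(1) = α, α_(2), …` with `α_(n+1) = T_H(α_(n))`, which terminates as soon as a
term is `0`, is purely periodic: it never terminates, and for some `m > 0` it is periodic with
period `m` from its first term on. Here `TH^[n] α` is `α_(n+1)`. -/
def PurelyPeriodic (α : ℂ) : Prop :=
  (∀ n : ℕ, TH^[n] α ≠ 0) ∧ ∃ m : ℕ, 0 < m ∧ ∀ n : ℕ, TH^[n + m] α = TH^[n] α

/-- `X_{j+1}` for `0 ≤ j ≤ 3`. -/
def petalX (j : ℕ) : Set ℂ :=
  {z | z ∈ X ∧ ∀ k ≤ 2, √2 / 2 < ‖z - I ^ (k + j) * (1 + I) / 2‖}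

/-- `X_{j+5}` for `0 ≤ j ≤ 3`. -/
def lensX (j : ℕ) : Set ℂ :=
  {z | z ∈ X ∧ ∀ k ≤ 1, ‖z - I ^ (k + j) * (1 - I) / 2‖ < √2 / 2}

/-- `W_{j+1}` for `0 ≤ j ≤ 3`. -/
def petalW (j : ℕ) : Set ℂ := {z | 1 < ‖z‖ ∧ 1 ≤ ‖z - I ^ j * (1 - I)‖}

/-- `W_{j+5}` for `0 ≤ j ≤ 3`. -/
def lensW (j : ℕ) : Set ℂ := {z | 1 < ‖z‖ ∧ ∀ k ≤ 1, 1 ≤ ‖z - I ^ (k + j) * (1 - I)‖}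

/-- `W ∪ {∞}` for `W ⊆ ℂ`, as a subset of the Riemann sphere. -/
def withInfty (W : Set ℂ) : Set (OnePoint ℂ) := (fun z : ℂ => (z : OnePoint ℂ)) '' W ∪ {OnePoint.infty}

/-- The modified natural-extension domain `X̃ ⊆ ℂ × (ℂ ∪ {∞})`, the union of
`closure X_j × (W_j ∪ {∞})` for `1 ≤ j ≤ 4` and of `X_j × (W_j ∪ {∞})` for `5 ≤ j ≤ 8`. -/
def Xtilde : Set (ℂ × OnePoint ℂ) :=
  (⋃ j ∈ Finset.range 4, closure (petalX j) ×ˢ withInfty (petalW j)) ∪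
  (⋃ j ∈ Finset.range 4, lensX j ×ˢ withInfty (lensW j))

/-- The field `ℚ(i)`, as a subfield of `ℂ`. -/
abbrev Qi : IntermediateField ℚ ℂ := IntermediateField.adjoin ℚ {I}

/-- `α` is a quadratic irrational over `ℚ(i)`: it is algebraic of degree exactly `2`. -/
def IsQuadraticIrrational (α : ℂ) : Prop := IsAlgebraic Qi α ∧ (minpoly Qi α).natDegree = 2

/-- `β` is the Galois conjugate over `ℚ(i)` of the quadratic irrational `α`: the root other than
`α` of the minimal polynomial of `α` over `ℚ(i)`. -/
def IsGaloisConjugate (α β : ℂ) : Prop := β ≠ α ∧ IsConjRoot Qi α β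

end JHurwitz

end

/-! ### Coordinates in the basis 1 + i, 1 - i, and the floor as rounding with ties towards zero. -/

noncomputable section

namespace JHurwitz

open Complex

/-! Let `natExt` act on conjugate pairs by (z, w) ↦ (1/z - a, 1/w - a) with a = ⌊1/z⌋_H. It keeps
the discriminant of the quadratic over ℤ[i] satisfied by z and w. In the coordinate ω = 1/w the
domain X̃ becomes `Fiber`: |ω| ≤ 1, and each of the four discs on the edges of the square that
contains z excludes ω from one open unit disc (`mem_Xtilde_iff`, `fiber_inv_iff`). `Fiber` has |w| ≥
1 where X̃ has |w| > 1, but for conjugate pairs |w| = 1 forces |z| = 1 (`QuadPair.norm_eq_one`), so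
the two agree. The closed domain is mapped into itself (`Fiber.step`).

If (α, α') lies in X̃, its orbit stays in the set of pairs of the same discriminant in the closed
domain. That set is finite (`finite_quadPair`) and `natExt` is injective on it, because the tie rule
determines the last digit (`digit_eq_of_step_eq`). An injective self-map of a finite set permutes
it, so α is purely periodic.

Conversely, a nonterminating orbit avoids ℚ(i) (`Orbit.irr`), and periodicity makes α a fixed point
of a Möbius map over ℤ[i], hence quadratic. The point w = ∞ lies in the fibre over every z, and its
orbit remains in the closed domain. Along multiples of the period that orbit converges to the
conjugate (`Orbit.tendsto_inftyOrbit`), and the fibre conditions over a fixed z are closed, so the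
conjugate satisfies them (`Orbit.fiber_inv`). -/

/-- The closed square with vertices `±1, ±i`. -/
def Diamond (z : ℂ) : Prop := |z.re + z.im| ≤ 1 ∧ |z.re - z.im| ≤ 1

/-- The homeomorphism `ℂ ≃ ℝ × ℝ` given by the coordinates in the basis `1 + i, 1 - i`. -/
def coordHomeo : ℂ ≃ₜ ℝ × ℝ where
  toFun z := ((z.re + z.im) / 2, (z.re - z.im) / 2)
  invFun p := ⟨p.1 + p.2, p.1 - p.2⟩
  left_inv z := by apply Complex.ext <;> simp <;> ring
  right_inv p := by ext <;> simp
  continuous_toFun := by fun_prop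
  continuous_invFun := by
    have : (fun p : ℝ × ℝ => (⟨p.1 + p.2, p.1 - p.2⟩ : ℂ)) =
        fun p => ((p.1 + p.2 : ℝ) : ℂ) + ((p.1 - p.2 : ℝ) : ℂ) * I := by
      funext p; apply Complex.ext <;> simp
    rw [this]; fun_prop

theorem coordHomeo_apply (z : ℂ) : coordHomeo z = ((z.re + z.im) / 2, (z.re - z.im) / 2) := rfl

theorem X_eq_preimage :
    X = coordHomeo ⁻¹' (Set.Ico (-(1 / 2)) (1 / 2) ×ˢ Set.Ico (-(1 / 2)) (1 / 2)) := by
  ext z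
  simp only [X, coordHomeo_apply, Set.mem_ofPred_eq, Set.mem_preimage, Set.mem_prod, Set.mem_Ico]
  constructor
  · rintro ⟨u, v, h1, h2, h3, h4, rfl⟩
    simp
    refine ⟨⟨?_, ?_⟩, ?_, ?_⟩ <;> linarith
  · rintro ⟨⟨h1, h2⟩, h3, h4⟩
    refine ⟨_, _, h1, h2, h3, h4, ?_⟩
    apply Complex.ext <;> simp <;> ring

theorem mem_X {z : ℂ} : z ∈ X ↔
    (-1 ≤ z.re + z.im ∧ z.re + z.im < 1) ∧ (-1 ≤ z.re - z.im ∧ z.re - z.im < 1) := by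
  rw [X_eq_preimage]
  simp only [coordHomeo_apply, Set.mem_preimage, Set.mem_prod,
    Set.mem_Ico]
  constructor <;> rintro ⟨⟨h1, h2⟩, h3, h4⟩ <;> refine ⟨⟨?_, ?_⟩, ?_, ?_⟩ <;> linarith

theorem mem_closure_X {z : ℂ} : z ∈ closure X ↔ Diamond z := by
  rw [X_eq_preimage, ← Homeomorph.preimage_closure, closure_prod_eq, closure_Ico (by norm_num)]
  simp only [coordHomeo_apply, Set.mem_preimage, Set.mem_prod,
    Set.mem_Icc, Diamond, abs_le]
  constructor <;> rintro ⟨⟨h1, h2⟩, h3, h4⟩ <;> refine ⟨⟨?_, ?_⟩, ?_, ?_⟩ <;> linarith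

theorem mem_interior_X {z : ℂ} :
    z ∈ interior X ↔ |z.re + z.im| < 1 ∧ |z.re - z.im| < 1 := by
  rw [X_eq_preimage, ← Homeomorph.preimage_interior, interior_prod_eq, interior_Ico]
  simp only [coordHomeo_apply, Set.mem_preimage, Set.mem_prod,
    Set.mem_Ioo, abs_lt]
  constructor <;> rintro ⟨⟨h1, h2⟩, h3, h4⟩ <;> refine ⟨⟨?_, ?_⟩, ?_, ?_⟩ <;> linarith

/-- The specification of the floor function: `a ∈ (1+i)ℤ[i]` is obtained from `ζ` by rounding the
coordinates in the basis `1 + i, 1 - i` to the nearest integer, ties going towards zero. -/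
structure IsFloor (ζ a : ℂ) : Prop where
  even : ∃ m l : ℤ, a = ⟨m + l, m - l⟩
  diamond : Diamond (ζ - a)
  plus_pos : 0 < a.re + a.im → -1 < (ζ - a).re + (ζ - a).im
  plus_neg : a.re + a.im < 0 → (ζ - a).re + (ζ - a).im < 1
  minus_pos : 0 < a.re - a.im → -1 < (ζ - a).re - (ζ - a).im
  minus_neg : a.re - a.im < 0 → (ζ - a).re - (ζ - a).im < 1

theorem mem_gaussInt {z : ℂ} : z ∈ gaussInt ↔ ∃ m n : ℤ, z = ⟨m, n⟩ := by
  constructor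
  · rintro ⟨g, rfl⟩
    exact ⟨g.re, g.im, by apply Complex.ext <;> simp⟩
  · rintro ⟨m, n, rfl⟩
    exact ⟨⟨m, n⟩, by apply Complex.ext <;> simp⟩

theorem evenGauss_coord {w : ℂ} (h : w ∈ evenGauss) : ∃ m l : ℤ, w = ⟨m + l, m - l⟩ := by
  obtain ⟨g, hg, rfl⟩ := h
  obtain ⟨m, n, rfl⟩ := mem_gaussInt.1 hg
  exact ⟨m, -n, by apply Complex.ext <;> simp <;> ring⟩

theorem coord_mem_evenGauss (m l : ℤ) : (⟨m + l, m - l⟩ : ℂ) ∈ evenGauss :=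
  ⟨⟨m, (-l : ℤ)⟩, mem_gaussInt.2 ⟨m, -l, rfl⟩, by apply Complex.ext <;> simp <;> ring⟩

theorem I_pow_cases {k : ℕ} (hk : k < 4) :
    I ^ k = 1 ∨ I ^ k = I ∨ I ^ k = -1 ∨ I ^ k = -I := by
  interval_cases k <;> simp [I_pow_three]

theorem IsFloor.of_interior {z w : ℂ} (hw : ∃ m l : ℤ, w = ⟨m + l, m - l⟩)
    (h : z - w ∈ interior X) : IsFloor z w := by
  obtain ⟨h1, h2⟩ := mem_interior_X.1 h
  rw [abs_lt] at h1 h2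
  exact ⟨hw, ⟨abs_le.2 ⟨h1.1.le, h1.2.le⟩, abs_le.2 ⟨h2.1.le, h2.2.le⟩⟩,
    fun _ => h1.1, fun _ => h1.2, fun _ => h2.1, fun _ => h2.2⟩

/-- The edges missing from a tile are those facing the origin: one for a ray tile, two for a sector
tile, none for w = 0. This is the rule that ties go towards zero. -/
theorem isFloor_of_mem_Q {z w : ℂ} (hw : w ∈ evenGauss) (hz : z ∈ Q w) : IsFloor z w := by
  have he := evenGauss_coord hw
  rcases hz with ⟨rfl, h⟩ | ⟨k, hk, hr, h⟩ | ⟨k, hk, hr, h⟩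
  · exact ⟨he, by simpa using mem_closure_X.1 h, by simp, by simp, by simp, by simp⟩
  · obtain ⟨m, hm, hr⟩ := hr
    have hm' : (0 : ℝ) < m := by exact_mod_cast hm
    set y := z - w with hy
    rcases h with h | h
    · exact .of_interior he h
    · rcases I_pow_cases hk with hI | hI | hI | hI <;>
      rcases h with (⟨u, h1, h2, h⟩ | ⟨u, h1, h2, h⟩) | ⟨u, h1, h2, h⟩ <;>
      (rw [hI] at hr h
       have hr1 := congrArg re hr
       have hr2 := congrArg im hr
       have hh1 := congrArg re h
       have hh2 := congrArg im h
       simp at hr1 hr2 hh1 hh2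
       constructor
       · exact he
       · rw [← hy, Diamond, abs_le, abs_le]
         refine ⟨⟨?_, ?_⟩, ?_, ?_⟩ <;> linarith
       all_goals (intro hpos; rw [← hy]; linarith))
  · obtain ⟨m, l, hm, hl, hr⟩ := hr
    have hm' : (0 : ℝ) < m := by exact_mod_cast hm
    have hl' : (0 : ℝ) < l := by exact_mod_cast hl
    set y := z - w with hy
    rcases h with h | h
    · exact .of_interior he h
    · rcases I_pow_cases hk with hI | hI | hI | hI <;>
      rcases h with ⟨u, h1, h2, h⟩ | ⟨u, h1, h2, h⟩ <;>
      (rw [hI] at hr h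
       have hr1 := congrArg re hr
       have hr2 := congrArg im hr
       have hh1 := congrArg re h
       have hh2 := congrArg im h
       simp at hr1 hr2 hh1 hh2
       constructor
       · exact he
       · rw [← hy, Diamond, abs_le, abs_le]
         refine ⟨⟨?_, ?_⟩, ?_, ?_⟩ <;> linarith
       all_goals (intro hpos; rw [← hy]; linarith))

/-- Rounding to the nearest integer, ties towards zero. -/
theorem exists_round (s : ℝ) : ∃ m : ℤ, -(1 / 2) ≤ s - m ∧ s - m ≤ 1 / 2 ∧
    (0 < m → -(1 / 2) < s - m) ∧ (m < 0 → s - m < 1 / 2) := by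
  rcases le_total 0 s with hs | hs
  · refine ⟨⌈s - 1 / 2⌉, ?_, ?_, fun _ => ?_, fun h => ?_⟩
    · linarith [Int.ceil_lt_add_one (s - 1 / 2)]
    · linarith [Int.le_ceil (s - 1 / 2)]
    · linarith [Int.ceil_lt_add_one (s - 1 / 2)]
    · exfalso
      have h1 : ⌈s - 1 / 2⌉ ≤ -1 := by omega
      have := Int.ceil_le.1 h1
      push_cast at this; linarith
  · refine ⟨⌊s + 1 / 2⌋, ?_, ?_, fun h => ?_, fun _ => ?_⟩
    · linarith [Int.floor_le (s + 1 / 2)]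
    · linarith [Int.lt_floor_add_one (s + 1 / 2)]
    · exfalso
      have h1 : 1 ≤ ⌊s + 1 / 2⌋ := by omega
      have := Int.le_floor.1 h1
      push_cast at this; linarith
    · linarith [Int.lt_floor_add_one (s + 1 / 2)]

theorem mem_rayEdges_or {k : ℕ} {y : ℂ} {u v : ℝ}
    (hy : y = u * I ^ k * (1 + I) + v * I ^ k * (1 - I))
    (hu : -(1 / 2) < u) (hu' : u ≤ 1 / 2) (hv : -(1 / 2) ≤ v) (hv' : v ≤ 1 / 2) :
    (|u| < 1 / 2 ∧ |v| < 1 / 2) ∨ y ∈ rayEdges k := by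
  rcases hu'.lt_or_eq with hu1 | rfl
  · rcases hv.lt_or_eq with hv1 | rfl
    · rcases hv'.lt_or_eq with hv2 | rfl
      · exact .inl ⟨abs_lt.2 ⟨hu, hu1⟩, abs_lt.2 ⟨hv1, hv2⟩⟩
      · exact .inr (.inr ⟨u, hu, hu', by rw [hy]; push_cast; ring⟩)
    · exact .inr (.inl (.inl ⟨u, hu, hu', by rw [hy]; push_cast; ring⟩))
  · exact .inr (.inl (.inr ⟨v, hv, hv', by rw [hy]; push_cast; ring⟩))

theorem mem_sectorEdges_or {k : ℕ} {y : ℂ} {u v : ℝ}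
    (hy : y = u * I ^ k * (1 + I) + v * I ^ k * (1 - I))
    (hu : -(1 / 2) < u) (hu' : u ≤ 1 / 2) (hv : -(1 / 2) < v) (hv' : v ≤ 1 / 2) :
    (|u| < 1 / 2 ∧ |v| < 1 / 2) ∨ y ∈ sectorEdges k := by
  rcases hu'.lt_or_eq with hu1 | rfl
  · rcases hv'.lt_or_eq with hv2 | rfl
    · exact .inl ⟨abs_lt.2 ⟨hu, hu1⟩, abs_lt.2 ⟨hv, hv2⟩⟩
    · exact .inr (.inl ⟨u, hu, hu', by rw [hy]; push_cast; ring⟩)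
  · exact .inr (.inr ⟨v, hv, hv', by rw [hy]; push_cast; ring⟩)

theorem mem_interior_X_of_coord {y c : ℂ} (hc : c = 1 ∨ c = I ∨ c = -1 ∨ c = -I) {u v : ℝ}
    (hy : y = u * c * (1 + I) + v * c * (1 - I)) (h : |u| < 1 / 2 ∧ |v| < 1 / 2) :
    y ∈ interior X := by
  rw [mem_interior_X]
  obtain ⟨h1, h2⟩ := h
  rw [abs_lt] at *
  rw [abs_lt]
  have e1 := congrArg re hy
  have e2 := congrArg im hy
  rcases hc with rfl | rfl | rfl | rfl <;> simp at e1 e2 <;>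
    refine ⟨⟨?_, ?_⟩, ?_, ?_⟩ <;> linarith

theorem mem_Q_of_ray {z w : ℂ} {k : ℕ} (hk : k < 4) {m : ℤ} (hm : 0 < m)
    (hw : w = I ^ k * (1 + I) * m) {u v : ℝ}
    (hy : z - w = u * I ^ k * (1 + I) + v * I ^ k * (1 - I))
    (hu : -(1 / 2) < u) (hu' : u ≤ 1 / 2) (hv : -(1 / 2) ≤ v) (hv' : v ≤ 1 / 2) : z ∈ Q w :=
  .inr (.inl ⟨k, hk, ⟨m, hm, hw⟩, (mem_rayEdges_or hy hu hu' hv hv').imp_left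
    (mem_interior_X_of_coord (I_pow_cases hk) hy)⟩)

theorem mem_Q_of_sector {z w : ℂ} {k : ℕ} (hk : k < 4) {m l : ℤ} (hm : 0 < m) (hl : 0 < l)
    (hw : w = I ^ k * (m * (1 + I) + l * (1 - I))) {u v : ℝ}
    (hy : z - w = u * I ^ k * (1 + I) + v * I ^ k * (1 - I))
    (hu : -(1 / 2) < u) (hu' : u ≤ 1 / 2) (hv : -(1 / 2) < v) (hv' : v ≤ 1 / 2) : z ∈ Q w :=
  .inr (.inr ⟨k, hk, ⟨m, l, hm, hl, hw⟩, (mem_sectorEdges_or hy hu hu' hv hv').imp_left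
    (mem_interior_X_of_coord (I_pow_cases hk) hy)⟩)

/-- The nine sign patterns of the two rounded coordinates are the origin, the four rays and the four
sectors; k is the rotation carrying the pattern to the standard one. -/
theorem exists_mem_Q (z : ℂ) : ∃ w ∈ evenGauss, z ∈ Q w := by
  obtain ⟨m, h1, h2, h3, h4⟩ := exists_round ((z.re + z.im) / 2)
  obtain ⟨l, k1, k2, k3, k4⟩ := exists_round ((z.re - z.im) / 2)
  set s := (z.re + z.im) / 2 - m with hs
  set t := (z.re - z.im) / 2 - l with ht
  refine ⟨_, coord_mem_evenGauss m l, ?_⟩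
  have hz : z - ⟨m + l, m - l⟩ = s * (1 + I) + t * (1 - I) := by
    apply Complex.ext <;> simp [hs, ht] <;> ring
  rcases lt_trichotomy m 0 with hm | rfl | hm <;> rcases lt_trichotomy l 0 with hl | rfl | hl
  · exact mem_Q_of_sector (k := 2) (m := -m) (l := -l) (u := -s) (v := -t) (by norm_num)
      (by omega) (by omega) (by apply Complex.ext <;> simp <;> ring)
      (by rw [hz, I_sq]; push_cast; ring) (by linarith [h4 hm]) (by linarith)
      (by linarith [k4 hl]) (by linarith)
  · exact mem_Q_of_ray (k := 2) (m := -m) (u := -s) (v := -t) (by norm_num) (by omega)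
      (by apply Complex.ext <;> simp) (by rw [hz, I_sq]; push_cast; ring)
      (by linarith [h4 hm]) (by linarith) (by linarith) (by linarith)
  · exact mem_Q_of_sector (k := 3) (m := l) (l := -m) (u := t) (v := -s) (by norm_num)
      (by omega) (by omega) (by apply Complex.ext <;> simp [I_pow_three] <;> ring)
      (by rw [hz, I_pow_three]; apply Complex.ext <;> simp <;> ring) (by linarith [k3 hl])
      (by linarith) (by linarith [h4 hm]) (by linarith)
  · exact mem_Q_of_ray (k := 1) (m := -l) (u := -t) (v := s) (by norm_num) (by omega)
      (by apply Complex.ext <;> simp) (by rw [hz]; apply Complex.ext <;> simp <;> ring)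
      (by linarith [k4 hl]) (by linarith) (by linarith) (by linarith)
  · refine .inl ⟨by apply Complex.ext <;> simp, mem_closure_X.2 ?_⟩
    simp only [Int.cast_zero, sub_zero] at hs ht
    rw [Diamond, abs_le, abs_le]
    refine ⟨⟨?_, ?_⟩, ?_, ?_⟩ <;> linarith
  · exact mem_Q_of_ray (k := 3) (m := l) (u := t) (v := -s) (by norm_num) (by omega)
      (by apply Complex.ext <;> simp [I_pow_three])
      (by rw [hz, I_pow_three]; apply Complex.ext <;> simp <;> ring)
      (by linarith [k3 hl]) (by linarith) (by linarith) (by linarith)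
  · exact mem_Q_of_sector (k := 1) (m := -l) (l := m) (u := -t) (v := s) (by norm_num)
      (by omega) (by omega) (by apply Complex.ext <;> simp <;> ring)
      (by rw [hz]; apply Complex.ext <;> simp <;> ring) (by linarith [k4 hl])
      (by linarith) (by linarith [h3 hm]) (by linarith)
  · exact mem_Q_of_ray (k := 0) (m := m) (u := s) (v := t) (by norm_num) (by omega)
      (by apply Complex.ext <;> simp) (by rw [hz]; ring)
      (by linarith [h3 hm]) (by linarith) (by linarith) (by linarith)
  · exact mem_Q_of_sector (k := 0) (m := m) (l := l) (u := s) (v := t) (by norm_num)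
      (by omega) (by omega) (by apply Complex.ext <;> simp <;> ring)
      (by rw [hz]; ring) (by linarith [h3 hm])
      (by linarith) (by linarith [k3 hl]) (by linarith)

/-- Existence of a tile is enough here: any value that `epsilon` may choose satisfies the
specification, so uniqueness plays no role. -/
theorem isFloor_floorH {ζ : ℂ} (h : ζ ∉ gaussInt) : IsFloor ζ (floorH ζ) := by
  have := Classical.epsilon_spec (p := fun w => w ∈ evenGauss ∧ ζ ∈ Q w)
    (by simpa using exists_mem_Q ζ)
  rw [floorH, if_neg h]
  exact isFloor_of_mem_Q this.1 this.2

end JHurwitz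

end

/-! ### The natural extension on the closed domain: invariance and injectivity. -/

noncomputable section

namespace JHurwitz

open Complex
open scoped ComplexConjugate

/-- The four Gaussian integers `±1 ± i` of norm two. -/
def IsCorner (c : ℂ) : Prop := (c.re = 1 ∨ c.re = -1) ∧ (c.im = 1 ∨ c.im = -1)

theorem IsCorner.neg {c : ℂ} (h : IsCorner c) : IsCorner (-c) := by
  obtain ⟨h1, h2⟩ := h
  constructor <;> simp <;> grind

theorem IsCorner.map_conj {c : ℂ} (h : IsCorner c) : IsCorner (conj c) := by
  obtain ⟨h1, h2⟩ := h
  constructor <;> simp <;> grind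

theorem IsCorner.coord {c : ℂ} (h : IsCorner c) : ∃ m l : ℤ, c = ⟨m + l, m - l⟩ := by
  obtain ⟨h1 | h1, h2 | h2⟩ := h
  · exact ⟨1, 0, by apply Complex.ext <;> simp [h1, h2]⟩
  · exact ⟨0, 1, by apply Complex.ext <;> simp [h1, h2]⟩
  · exact ⟨0, -1, by apply Complex.ext <;> simp [h1, h2]⟩
  · exact ⟨-1, 0, by apply Complex.ext <;> simp [h1, h2]⟩

/-- `z` lies in the open disc of radius `√2/2` centred at `c/2`. -/
def InDisc (c z : ℂ) : Prop := z.re ^ 2 + z.im ^ 2 < c.re * z.re + c.im * z.im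

/-- The condition on `ω = 1/w` for `w` to lie in the closed fibre above `z`. -/
def Fiber (z ω : ℂ) : Prop :=
  ‖ω‖ ≤ 1 ∧ ∀ c, IsCorner c → InDisc c z → 1 ≤ ‖ω - conj c‖

/-- Elements of (1+i)ℤ[i] have modulus 0, √2 or at least 2, and those of modulus at least 2 are at
distance at least 1 from the unit disc. Only corners can obstruct. -/
theorem even_cases {ω : ℂ} (hω : ‖ω‖ ≤ 1) (m l : ℤ) :
    (⟨m + l, m - l⟩ : ℂ) = 0 ∨ IsCorner ⟨m + l, m - l⟩ ∨ 1 ≤ ‖ω - ⟨m + l, m - l⟩‖ := by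
  by_cases h : 2 ≤ m ^ 2 + l ^ 2
  · right; right
    have h2 : (2 : ℝ) ≤ m ^ 2 + l ^ 2 := by exact_mod_cast h
    have : 2 ≤ ‖(⟨m + l, m - l⟩ : ℂ)‖ := by
      rw [← abs_of_pos (zero_lt_two (α := ℝ)), ← abs_norm, ← sq_le_sq, ← normSq_eq_norm_sq,
        normSq_apply]
      nlinarith
    have h3 := norm_sub_norm_le (⟨m + l, m - l⟩ : ℂ) ω
    rw [norm_sub_rev] at h3
    linarith
  · have hm : m ^ 2 ≤ 1 := by nlinarith [sq_nonneg l]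
    have hl : l ^ 2 ≤ 1 := by nlinarith [sq_nonneg m]
    have hm1 : m ≤ 1 := by nlinarith
    have hm2 : -1 ≤ m := by nlinarith
    have hl1 : l ≤ 1 := by nlinarith
    have hl2 : -1 ≤ l := by nlinarith
    interval_cases m <;> interval_cases l <;> simp_all [IsCorner, Complex.ext_iff]

theorem IsFloor.tie {ζ a c : ℂ} (h : IsFloor ζ a) (hc : IsCorner c)
    (hp : 0 < c.re * a.re + c.im * a.im) :
    -1 < c.re * (ζ - a).re + c.im * (ζ - a).im := by
  have h1 := h.plus_pos
  have h2 := h.plus_neg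
  have h3 := h.minus_pos
  have h4 := h.minus_neg
  obtain ⟨hr | hr, hi | hi⟩ := hc <;> rw [hr, hi] at hp ⊢
  · linarith [h1 (by linarith)]
  · linarith [h3 (by linarith)]
  · linarith [h4 (by linarith)]
  · linarith [h2 (by linarith)]

theorem Diamond.abs_le_one {z c : ℂ} (h : Diamond z) (hc : IsCorner c) :
    |c.re * z.re + c.im * z.im| ≤ 1 := by
  obtain ⟨h1, h2⟩ := h
  rw [abs_le] at *
  obtain ⟨hr | hr, hi | hi⟩ := hc <;> rw [hr, hi] <;> constructor <;> linarith

theorem Diamond.le_one {z c : ℂ} (h : Diamond z) (hc : IsCorner c) :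
    c.re * z.re + c.im * z.im ≤ 1 := (abs_le.1 (h.abs_le_one hc)).2

theorem Diamond.neg_one_le {z c : ℂ} (h : Diamond z) (hc : IsCorner c) :
    -1 ≤ c.re * z.re + c.im * z.im := (abs_le.1 (h.abs_le_one hc)).1

/-- One step of the natural extension, in the coordinates `ζ = 1/z` and `ω = 1/w`. -/
theorem fiber_step {ζ ω a : ℂ} (hf : IsFloor ζ a) (ha : a ≠ 0)
    (hout : ∀ c, IsCorner c → c.re * ζ.re + c.im * ζ.im ≤ ζ.re ^ 2 + ζ.im ^ 2)
    (hω : ‖ω‖ ≤ 1)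
    (hfib : ∀ c, IsCorner c → 1 < c.re * ζ.re + c.im * ζ.im → 1 ≤ ‖ω - c‖) :
    1 ≤ ‖ω - a‖ ∧ ∀ c, IsCorner c → InDisc c (ζ - a) → 1 ≤ ‖ω - a - c‖ := by
  have hd := hf.diamond
  have ht := fun c hc => hf.tie (c := c) hc
  obtain ⟨m, l, rfl⟩ := hf.even
  constructor
  · rcases even_cases hω m l with h | h | h
    · exact absurd h ha
    -- Here a is a corner. The tie rule gives a·(ζ - a) > -1, and |a|² = 2, so a·ζ > 1.
    · refine hfib _ h ?_
      have := ht _ h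
      simp only [sub_re, sub_im] at this
      obtain ⟨hr | hr, hi | hi⟩ := h <;> simp only [] at hr hi <;> rw [hr, hi] at this ⊢ <;>
        linarith [this (by norm_num)]
    · exact h
  · intro c hc hin
    obtain ⟨m', l', rfl⟩ := hc.coord
    rw [sub_sub]
    have e : (⟨m + l, m - l⟩ + ⟨m' + l', m' - l'⟩ : ℂ) =
        ⟨(m + m' : ℤ) + (l + l' : ℤ), (m + m' : ℤ) - (l + l' : ℤ)⟩ := by
      apply Complex.ext <;> simp <;> ring
    set a : ℂ := ⟨m + l, m - l⟩ with ha'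
    set c : ℂ := ⟨m' + l', m' - l'⟩ with hc'
    rw [e]
    rcases even_cases hω (m + m') (l + l') with h | h | h
    -- If a = -c, the disc condition on ζ - a = ζ + c reads |ζ|² < -c·ζ, against `hout` at -c.
    · exfalso
      rw [← e] at h
      have := hout (-c) hc.neg
      have e1 : a = -c := eq_neg_of_add_eq_zero_left h
      rw [InDisc, e1] at hin
      simp only [sub_re, sub_im, neg_re, neg_im] at hin this
      have h1 : c.re ^ 2 = 1 := by rcases hc.1 with h | h <;> rw [h] <;> norm_num
      have h2 : c.im ^ 2 = 1 := by rcases hc.2 with h | h <;> rw [h] <;> norm_num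
      nlinarith
    -- Put b = a + c and y = ζ - a; then b ≠ c, so b·c is 0 or -2 and b·a = 2 - b·c. With b·y ≥ -1
    -- this gives b·ζ ≥ 1. Equality would need b ⊥ c and b·y = -1, but that line is tangent to the
    -- open disc of c.
    · refine hfib _ h ?_
      rw [← e] at h ⊢
      have h1 := hd.neg_one_le h
      rw [InDisc] at hin
      have e3 : ζ.re = (ζ - a).re + a.re := by simp
      have e4 : ζ.im = (ζ - a).im + a.im := by simp
      rw [e3, e4]
      generalize (ζ - a) = y at *
      obtain ⟨b, hb⟩ : ∃ b, b = a + c := ⟨_, rfl⟩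
      have ea : a = b - c := by rw [hb]; ring
      rw [← hb] at h h1 ⊢
      have hbc : b ≠ c := by rintro rfl; apply ha; rw [ea]; ring
      rw [ea]
      simp only [sub_re, sub_im]
      clear_value a c
      obtain ⟨hr | hr, hi | hi⟩ := h <;> obtain ⟨kr | kr, ki | ki⟩ := hc <;>
        rw [hr, hi] at h1 <;> rw [kr, ki] at hin <;> rw [hr, hi, kr, ki] <;>
        first
        | exact absurd (Complex.ext (hr.trans kr.symm) (hi.trans ki.symm)) hbc
        | nlinarith [sq_nonneg (y.re - 1), sq_nonneg (y.re + 1), sq_nonneg (y.im - 1),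
            sq_nonneg (y.im + 1), sq_nonneg y.re, sq_nonneg y.im]
    · exact h

theorem inv_re' (z : ℂ) : (z⁻¹).re = z.re / (z.re ^ 2 + z.im ^ 2) := by
  rw [inv_re, normSq_apply, sq, sq]

theorem inv_im' (z : ℂ) : (z⁻¹).im = -z.im / (z.re ^ 2 + z.im ^ 2) := by
  rw [inv_im, normSq_apply, sq, sq]

theorem sq_add_sq_pos {z : ℂ} (hz : z ≠ 0) : 0 < z.re ^ 2 + z.im ^ 2 := by
  have := normSq_pos.2 hz
  rwa [normSq_apply, ← sq, ← sq] at this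

/-- Inversion turns a circle through 0 into a line; the discs defining the petals become half-planes
for 1/z. -/
theorem one_lt_inv_iff_inDisc {z c : ℂ} (hz : z ≠ 0) :
    1 < c.re * (z⁻¹).re + c.im * (z⁻¹).im ↔ InDisc (conj c) z := by
  have := sq_add_sq_pos hz
  rw [inv_re', inv_im', InDisc, conj_re, conj_im]
  rw [show c.re * (z.re / (z.re ^ 2 + z.im ^ 2)) + c.im * (-z.im / (z.re ^ 2 + z.im ^ 2)) =
    (c.re * z.re + -c.im * z.im) / (z.re ^ 2 + z.im ^ 2) by ring, one_lt_div this]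

theorem Diamond.inv_out {z c : ℂ} (hz : z ≠ 0) (hd : Diamond z) (hc : IsCorner c) :
    c.re * (z⁻¹).re + c.im * (z⁻¹).im ≤ (z⁻¹).re ^ 2 + (z⁻¹).im ^ 2 := by
  have := sq_add_sq_pos hz
  have h := hd.le_one hc.map_conj
  rw [inv_re', inv_im']
  rw [conj_re, conj_im] at h
  rw [show c.re * (z.re / (z.re ^ 2 + z.im ^ 2)) + c.im * (-z.im / (z.re ^ 2 + z.im ^ 2)) =
    (c.re * z.re + -c.im * z.im) / (z.re ^ 2 + z.im ^ 2) by ring,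
    show (z.re / (z.re ^ 2 + z.im ^ 2)) ^ 2 + (-z.im / (z.re ^ 2 + z.im ^ 2)) ^ 2 =
      1 / (z.re ^ 2 + z.im ^ 2) by field_simp]
  gcongr

theorem Diamond.norm_le_one {z : ℂ} (hd : Diamond z) : ‖z‖ ≤ 1 := by
  obtain ⟨h1, h2⟩ := hd
  rw [abs_le] at h1 h2
  rw [← sq_le_one_iff₀ (norm_nonneg z), ← normSq_eq_norm_sq, normSq_apply]
  nlinarith

/-- The points of the closed square on the unit circle are its vertices. -/
theorem Diamond.mem_gaussInt {z : ℂ} (hd : Diamond z) (h : ‖z‖ = 1) :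
    z = 1 ∨ z = -1 ∨ z = I ∨ z = -I := by
  obtain ⟨h1, h2⟩ := hd
  rw [abs_le] at h1 h2
  have h3 : z.re * z.re + z.im * z.im = 1 := by
    rw [← normSq_apply, normSq_eq_norm_sq, h, one_pow]
  have h5 : z.re * z.im = 0 := by
    have : (z.re + z.im) ^ 2 ≤ 1 := by nlinarith
    have : (z.re - z.im) ^ 2 ≤ 1 := by nlinarith
    nlinarith
  rcases mul_eq_zero.1 h5 with h | h
  · rw [h] at h3
    have : z.im = 1 ∨ z.im = -1 := by rw [← sq_eq_one_iff]; linarith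
    rcases this with h' | h' <;> simp [Complex.ext_iff, h, h']
  · rw [h] at h3
    have : z.re = 1 ∨ z.re = -1 := by rw [← sq_eq_one_iff]; linarith
    rcases this with h' | h' <;> simp [Complex.ext_iff, h, h']

theorem Diamond.inv_mem_gaussInt {z : ℂ} (hd : Diamond z) (h : ‖z‖ = 1) : z⁻¹ ∈ gaussInt := by
  rcases hd.mem_gaussInt h with rfl | rfl | rfl | rfl <;> rw [JHurwitz.mem_gaussInt]
  · exact ⟨1, 0, by apply Complex.ext <;> simp⟩
  · exact ⟨-1, 0, by apply Complex.ext <;> simp [inv_neg]⟩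
  · exact ⟨0, -1, by apply Complex.ext <;> simp⟩
  · exact ⟨0, 1, by apply Complex.ext <;> simp [inv_neg]⟩

theorem Diamond.mem_gaussInt_of_inv {z : ℂ} (hz : z ≠ 0) (hd : Diamond z)
    (hd' : Diamond z⁻¹) : z⁻¹ ∈ gaussInt := by
  apply hd.inv_mem_gaussInt
  have h1 := hd.norm_le_one
  have h2 := hd'.norm_le_one
  rw [norm_inv] at h2
  have h3 := norm_pos_iff.2 hz
  exact le_antisymm h1 ((inv_le_one₀ h3).1 h2)

/-- The partial quotient `⌊1/z⌋_H`. -/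
def digit (z : ℂ) : ℂ := floorH z⁻¹

theorem TH_eq {z : ℂ} (hz : z ≠ 0) : TH z = z⁻¹ - digit z := by
  rw [TH, if_neg hz, one_div, digit]

theorem inv_notMem_gaussInt_of_TH_ne_zero {z : ℂ} (hz : TH z ≠ 0) : z ≠ 0 ∧ z⁻¹ ∉ gaussInt := by
  have h0 : z ≠ 0 := by
    rintro rfl; simp [TH] at hz
  refine ⟨h0, fun h => hz ?_⟩
  rw [TH_eq h0, digit, floorH, if_pos h, sub_self]

theorem isFloor_digit {z : ℂ} (h : z⁻¹ ∉ gaussInt) : IsFloor z⁻¹ (digit z) :=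
  isFloor_floorH h

theorem digit_ne_zero {z : ℂ} (hz : z ≠ 0) (hd : Diamond z) (h : z⁻¹ ∉ gaussInt) :
    digit z ≠ 0 := by
  intro h0
  have := (isFloor_digit h).diamond
  rw [h0, sub_zero] at this
  exact h (hd.mem_gaussInt_of_inv hz this)

/-- The unit circle about a corner is orthogonal to the unit circle about 0, since |c|² = 1 + 1;
hence inversion in the latter preserves its exterior. -/
theorem norm_inv_sub_conj {ω c : ℂ} (hω : ω ≠ 0) (hc : IsCorner c) :
    1 ≤ ‖ω⁻¹ - conj c‖ ↔ 1 ≤ ‖ω - c‖ := by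
  have h1 : ∀ x : ℂ, 1 ≤ ‖x‖ ↔ 1 ≤ x.re ^ 2 + x.im ^ 2 := fun x => by
    rw [← one_le_sq_iff₀ (norm_nonneg x), ← normSq_eq_norm_sq, normSq_apply, sq, sq]
  have := sq_add_sq_pos hω
  have hr : c.re ^ 2 = 1 := by rcases hc.1 with h | h <;> rw [h] <;> norm_num
  have hi : c.im ^ 2 = 1 := by rcases hc.2 with h | h <;> rw [h] <;> norm_num
  rw [h1, h1]
  simp only [sub_re, sub_im, conj_re, conj_im, inv_re', inv_im']
  have e : (ω.re / (ω.re ^ 2 + ω.im ^ 2) - c.re) ^ 2 + (-ω.im / (ω.re ^ 2 + ω.im ^ 2) - -c.im) ^ 2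
      = (1 - 2 * (c.re * ω.re + c.im * ω.im)) / (ω.re ^ 2 + ω.im ^ 2) + 2 := by
    field_simp
    linear_combination (ω.re ^ 2 + ω.im ^ 2) ^ 2 * (hr + hi)
  rw [e, ← sub_le_iff_le_add, show (1 : ℝ) - 2 = -1 by norm_num, le_div_iff₀ this]
  constructor <;> intro h <;> nlinarith

/-- The closed natural-extension domain is invariant. -/
theorem Fiber.step {z ω : ℂ} (hz : z ≠ 0) (hd : Diamond z) (h : z⁻¹ ∉ gaussInt)
    (hf : Fiber z ω) : 1 ≤ ‖ω - digit z‖ ∧ Fiber (TH z) (ω - digit z)⁻¹ := by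
  obtain ⟨h1, h2⟩ := fiber_step (isFloor_digit h) (digit_ne_zero hz hd h)
    (fun c hc => hd.inv_out hz hc) hf.1
    (fun c hc hlt => by
      simpa using hf.2 _ hc.map_conj ((one_lt_inv_iff_inDisc hz).1 hlt))
  refine ⟨h1, ?_, fun c hc hin => ?_⟩
  · rw [norm_inv]; exact inv_le_one_of_one_le₀ h1
  · rw [TH_eq hz] at hin
    rw [norm_inv_sub_conj _ hc]
    · exact h2 c hc hin
    · intro h0; rw [h0, norm_zero] at h1; linarith

theorem Fiber.norm_add_lt {z ω c : ℂ} (hz : z ≠ 0) (hf : Fiber z ω) (hc : IsCorner c)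
    (h : ‖ω - c‖ < 1) : c.re * (z⁻¹).re + c.im * (z⁻¹).im ≤ 1 := by
  by_contra! hlt
  have := hf.2 _ hc.map_conj ((one_lt_inv_iff_inDisc hz).1 hlt)
  rw [conj_conj] at this
  linarith

/-- Injectivity of the natural extension. -/
theorem digit_eq_of_step_eq {z z' ω ω' : ℂ} (hz : z ≠ 0) (hz' : z' ≠ 0)
    (h : z⁻¹ ∉ gaussInt) (h' : z'⁻¹ ∉ gaussInt) (hf : Fiber z ω) (hf' : Fiber z' ω')
    (hω : ‖ω‖ < 1) (hω' : ‖ω'‖ < 1) (e1 : TH z = TH z')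
    (e2 : ω - digit z = ω' - digit z') : digit z = digit z' := by
  rw [TH_eq hz, TH_eq hz'] at e1
  have F := isFloor_digit h
  have F' := isFloor_digit h'
  have k1 := fun c => hf.norm_add_lt (c := c) hz
  have k2 := fun c => hf'.norm_add_lt (c := c) hz'
  have hd := F.diamond
  have ht := fun c hc => F.tie (c := c) hc
  have ht' := fun c hc => F'.tie (c := c) hc
  obtain ⟨m, l, hm⟩ := F.even
  obtain ⟨m', l', hm'⟩ := F'.even
  set a := digit z
  set a' := digit z'
  set ζ := z⁻¹
  set ζ' := z'⁻¹
  have e : a - a' = ⟨(m - m' : ℤ) + (l - l' : ℤ), (m - m' : ℤ) - (l - l' : ℤ)⟩ := by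
    rw [hm, hm']; apply Complex.ext <;> simp <;> ring
  have e3 : ω - (a - a') = ω' := by linear_combination e2
  have e4 : ω' - -(a - a') = ω := by linear_combination -e2
  rcases even_cases hω.le (m - m') (l - l') with h0 | h0 | h0 <;> rw [← e] at h0
  · exact sub_eq_zero.1 h0
  -- Let ε = a - a' be a corner and y the common image. As ω and ω' = ω - ε are in the unit disc,
  -- the fibres force ε·ζ ≤ 1 and -ε·ζ' ≤ 1, which together give ε·(y + a) = 1. Since ε·a is even
  -- and |ε·y| ≤ 1, ε·a is 0 or 2, and y lies on an edge that the tie rule forbids for a' or for a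
  -- respectively.
  · exfalso
    have h1 := k1 _ h0 (by rwa [e3])
    have h2 := k2 _ h0.neg (by rwa [e4])
    have h3 := ht _ h0
    have h4 := ht' _ h0.neg
    have h6 := hd.abs_le_one h0
    rw [← e1] at h4
    have e5 : ζ = (ζ - a) + a := by ring
    have e6 : ζ' = (ζ - a) + a - (a - a') := by linear_combination -e1
    rw [e6] at h2
    rw [e5] at h1
    have e7 : a' = a - (a - a') := by ring
    rw [abs_le] at h6
    generalize hε : a - a' = ε at *
    rw [e7] at h4
    generalize ζ - a = y at *
    simp only [neg_re, neg_im, sub_re, sub_im, add_re, add_im] at *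
    have hpar : ∃ n : ℤ, ε.re * a.re + ε.im * a.im = 2 * n := by
      rw [hm]
      obtain ⟨hr | hr, hi | hi⟩ := h0 <;> rw [hr, hi]
      · exact ⟨m, by simp; ring⟩
      · exact ⟨l, by simp; ring⟩
      · exact ⟨-l, by simp; ring⟩
      · exact ⟨-m, by simp; ring⟩
    have hr : ε.re ^ 2 = 1 := by rcases h0.1 with h | h <;> rw [h] <;> norm_num
    have hi : ε.im ^ 2 = 1 := by rcases h0.2 with h | h <;> rw [h] <;> norm_num
    obtain ⟨n, hn⟩ := hpar
    have hn0 : 0 ≤ n := by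
      by_contra! hn0
      have : (n : ℝ) ≤ -1 := by exact_mod_cast Int.le_sub_one_of_lt hn0
      nlinarith
    have hn1 : n ≤ 1 := by
      by_contra! hn0
      have : (2 : ℝ) ≤ n := by exact_mod_cast hn0
      nlinarith
    interval_cases n
    · have := h4 (by push_cast at hn; nlinarith)
      push_cast at hn
      nlinarith
    · have := h3 (by push_cast at hn; nlinarith)
      push_cast at hn
      nlinarith
  · rw [e3] at h0; linarith

end JHurwitz

end

/-! ### Conjugate pairs over ℤ[i], and finiteness of those with given discriminant. -/

noncomputable section

namespace JHurwitz

open Complex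
open scoped ComplexConjugate

/-- `z` does not belong to the field `ℚ(i)`. -/
def Irr (z : ℂ) : Prop := ∀ p q : GaussianInt, (p : ℂ) * z = q → p = 0

theorem Irr.ne_zero {z : ℂ} (h : Irr z) : z ≠ 0 := by
  rintro rfl
  exact one_ne_zero (h 1 0 (by simp))

theorem Irr.inv_notMem {z : ℂ} (h : Irr z) : z⁻¹ ∉ gaussInt := by
  rintro ⟨g, hg⟩
  have h0 := h.ne_zero
  have := h g 1 (by rw [hg, inv_mul_cancel₀ h0, map_one])
  rw [this, map_zero] at hg
  exact inv_ne_zero h0 hg.symm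

theorem Irr.inv_sub {z : ℂ} (h : Irr z) (a : GaussianInt) : Irr (z⁻¹ - a) := by
  intro p q hpq
  have h0 := h.ne_zero
  have h1 := h (q + p * a) p (by
    push_cast [map_add, map_mul]
    rw [← hpq]; field_simp; ring)
  have h2 : (p : ℂ) = 0 := by
    have : (p : ℂ) * z⁻¹ = ((q + p * a : GaussianInt) : ℂ) := by
      simp only [map_add, map_mul]; rw [← hpq]; ring
    rw [h1, map_zero] at this
    exact (mul_eq_zero.1 this).resolve_right (inv_ne_zero h0)
  simpa using h2

/-- `z ∉ ℚ(i)` and `w` are the two roots of the polynomial `A x ^ 2 + B x + C`. -/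
structure QuadPair (A B C : GaussianInt) (z w : ℂ) : Prop where
  ne_zero : A ≠ 0
  irr : Irr z
  sum : (A : ℂ) * (z + w) = -B
  prod : (A : ℂ) * (z * w) = C

namespace QuadPair

variable {A B C : GaussianInt} {z w : ℂ}

theorem coe_ne_zero (h : QuadPair A B C z w) : (A : ℂ) ≠ 0 := by
  simpa using h.ne_zero

theorem irr_right (h : QuadPair A B C z w) : Irr w := by
  intro p q hpq
  have := h.irr (p * A) (-p * B - q * A) (by
    simp only [map_mul, map_sub, map_neg]
    linear_combination (p : ℂ) * h.sum - A * hpq)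
  exact (mul_eq_zero.1 this).resolve_right h.ne_zero

theorem ne (h : QuadPair A B C z w) : z ≠ w := by
  rintro rfl
  have := h.irr (2 * A) (-B) (by simp only [map_mul, map_neg, map_ofNat]; linear_combination h.sum)
  exact h.ne_zero ((mul_eq_zero.1 this).resolve_left two_ne_zero)

theorem root (h : QuadPair A B C z w) (x : ℂ) :
    (A : ℂ) * x ^ 2 + B * x + C = A * ((x - z) * (x - w)) := by
  linear_combination x * h.sum - h.prod

/-- Substitute x = 1/(y + a) and clear denominators; the new leading coefficient is C = A z w,
nonzero because neither root is in ℚ(i). -/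
theorem step (h : QuadPair A B C z w) (a : GaussianInt) :
    QuadPair C (B + 2 * a * C) (A + B * a + C * a ^ 2) (z⁻¹ - a) (w⁻¹ - a) := by
  have hz := h.irr.ne_zero
  have hw := h.irr_right.ne_zero
  have hA := h.coe_ne_zero
  refine ⟨?_, h.irr.inv_sub a, ?_, ?_⟩
  · have : (C : ℂ) ≠ 0 := by rw [← h.prod]; positivity
    simpa using this
  · simp only [map_add, map_mul, map_ofNat]
    rw [← h.prod]
    field_simp
    linear_combination h.sum
  · simp only [map_add, map_mul, map_pow]
    have e := h.sum
    rw [← h.prod]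
    field_simp
    linear_combination -(a : ℂ) * h.sum

theorem disc_step (A B C a : GaussianInt) :
    (B + 2 * a * C) ^ 2 - 4 * C * (A + B * a + C * a ^ 2) = B ^ 2 - 4 * A * C := by ring

theorem disc (h : QuadPair A B C z w) :
    ((A : ℂ) * (z - w)) ^ 2 = ((B ^ 2 - 4 * A * C : GaussianInt) : ℂ) := by
  simp only [map_sub, map_mul, map_pow, map_ofNat]
  linear_combination (A * (z + w) - B) * h.sum - 4 * A * h.prod

/-- If one root is on the unit circle, then so is the other one. -/
theorem norm_eq_one (h : QuadPair A B C z w) (hw : ‖w‖ = 1) : ‖z‖ = 1 := by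
  have h1 : (A : ℂ) * w ^ 2 + B * w + C = 0 := by rw [h.root]; ring
  have hc : w * conj w = 1 := by rw [mul_conj, normSq_eq_norm_sq, hw]; simp
  have h2 : conj (A : ℂ) * conj w ^ 2 + conj (B : ℂ) * conj w + conj (C : ℂ) = 0 := by
    have := congrArg conj h1
    simpa only [map_add, map_mul, map_pow, map_zero] using this
  -- As conj w = 1/w, w is also a root of the reversed conjugate polynomial. Since w ∉ ℚ(i), the two
  -- polynomials are proportional, which yields |C| = |A|, that is |z w| = 1.
  have h3 : conj (A : ℂ) + conj (B : ℂ) * w + conj (C : ℂ) * w ^ 2 = 0 := by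
    linear_combination w ^ 2 * h2 - conj (A : ℂ) * (w * conj w + 1) * hc
      - conj (B : ℂ) * w * hc
  have h4 := h.irr_right (A * star B - B * star C) (C * star C - A * star A) (by
    simp only [map_sub, map_mul, GaussianInt.toComplex_star]
    linear_combination (A : ℂ) * h3 - conj (C : ℂ) * h1)
  have h4' : (A : ℂ) * conj (B : ℂ) - B * conj (C : ℂ) = 0 := by
    have := congrArg GaussianInt.toComplex h4
    simpa only [map_sub, map_mul, GaussianInt.toComplex_star, map_zero] using this
  have h5 : (C : ℂ) * conj (C : ℂ) = A * conj (A : ℂ) := by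
    linear_combination -(A : ℂ) * h3 + conj (C : ℂ) * h1 + w * h4'
  rw [mul_conj, mul_conj, ofReal_inj, normSq_eq_norm_sq, normSq_eq_norm_sq,
    sq_eq_sq₀ (norm_nonneg _) (norm_nonneg _), ← h.prod, norm_mul, norm_mul, hw, mul_one] at h5
  exact mul_left_cancel₀ (norm_ne_zero_iff.2 h.coe_ne_zero) (by rw [h5, mul_one])

/-- Eliminating the square leaves a linear relation for z over ℤ[i], which must be trivial; so both
quadratics have the same sum of roots. -/
theorem right_unique {w' : ℂ} {A' B' C' : GaussianInt} (h : QuadPair A B C z w)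
    (h' : QuadPair A' B' C' z w') : w = w' := by
  have e1 := h.root z
  have e2 := h'.root z
  rw [sub_self, zero_mul, mul_zero] at e1 e2
  have h1 := h.irr (A * B' - A' * B) (A' * C - A * C') (by
    simp only [map_sub, map_mul]
    linear_combination (A : ℂ) * e2 - (A' : ℂ) * e1)
  have h2 : (A : ℂ) * B' - A' * B = 0 := by
    have := congrArg GaussianInt.toComplex h1
    simpa only [map_sub, map_mul, map_zero] using this
  have hA := h.coe_ne_zero
  have hA' := h'.coe_ne_zero
  have : (A : ℂ) * A' * (w - w') = 0 := by
    linear_combination (A' : ℂ) * h.sum - (A : ℂ) * h'.sum + h2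
  exact sub_eq_zero.1 ((mul_eq_zero.1 this).resolve_left (mul_ne_zero hA hA'))

end QuadPair

theorem one_le_norm_coe {g : GaussianInt} (hg : g ≠ 0) : 1 ≤ ‖(g : ℂ)‖ := by
  rw [← one_le_sq_iff₀ (norm_nonneg _), ← normSq_eq_norm_sq, normSq_apply,
    ← GaussianInt.intCast_re, ← GaussianInt.intCast_im]
  have : 1 ≤ g.re * g.re + g.im * g.im := by
    by_contra! hlt
    have h1 : g.re = 0 := by nlinarith [mul_self_nonneg g.re, mul_self_nonneg g.im]
    have h2 : g.im = 0 := by nlinarith [mul_self_nonneg g.re, mul_self_nonneg g.im]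
    exact hg (Zsqrtd.ext h1 h2)
  exact_mod_cast this

theorem finite_norm_le (R : ℝ) : {g : GaussianInt | ‖(g : ℂ)‖ ≤ R}.Finite := by
  have hf : (Set.Icc (-⌈R⌉) ⌈R⌉ ×ˢ Set.Icc (-⌈R⌉) ⌈R⌉ : Set (ℤ × ℤ)).Finite :=
    (Set.finite_Icc _ _).prod (Set.finite_Icc _ _)
  refine (hf.image fun p : ℤ × ℤ => (⟨p.1, p.2⟩ : GaussianInt)).subset fun g hg => ?_
  refine ⟨(g.re, g.im), ?_, rfl⟩
  have h1 := (abs_re_le_norm (g : ℂ)).trans hg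
  have h2 := (abs_im_le_norm (g : ℂ)).trans hg
  rw [← GaussianInt.intCast_re, abs_le] at h1
  rw [← GaussianInt.intCast_im, abs_le] at h2
  have h3 := Int.le_ceil R
  refine ⟨⟨?_, ?_⟩, ?_, ?_⟩ <;> simp only [] <;> rify <;> linarith

/-- A root in the closed square near the vertex `1`, the other root outside the unit disc, and
`|A (1 - z) (1 - w)| ≥ 1` bound the leading coefficient. -/
theorem norm_le_of_cone {A z w : ℂ} (hd : Diamond z) (hre : |z.im| ≤ z.re) (hw : 1 ≤ ‖w‖)
    (hv : 1 ≤ ‖A * ((1 - z) * (1 - w))‖) :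
    ‖A‖ ≤ 2 * ‖A * (z - w)‖ * (1 + 2 * ‖A * (z - w)‖) := by
  have hA : A ≠ 0 := by rintro rfl; norm_num at hv
  have hz1 : 1 - z ≠ 0 := by intro h; rw [h] at hv; norm_num at hv
  have hw1 : 1 - w ≠ 0 := by intro h; rw [h] at hv; norm_num at hv
  set d := ‖A * (z - w)‖ with hdd
  obtain ⟨hd1, hd2⟩ := hd
  rw [abs_le] at hd1 hd2 hre
  have him : |z.im| ≤ 1 - z.re := by rw [abs_le]; constructor <;> linarith
  rw [abs_le] at him
  have hpos := sq_add_sq_pos hz1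
  have hpos' := sq_add_sq_pos hw1
  have he : 0 < 1 - z.re := by
    rcases lt_or_eq_of_le (show z.re ≤ 1 by linarith) with h | h
    · linarith
    · exfalso; apply hz1
      apply Complex.ext
      · simp [h]
      · simp; linarith
  simp only [sub_re, one_re, sub_im, one_im, zero_sub, neg_sq] at hpos hpos'
  -- The map x ↦ 1/(1 - x) sends the exterior of the unit disc to Re ≤ 1/2, and z close to 1 in the
  -- square far to the right. The two images differ by A(z - w) divided by a number of modulus at
  -- least 1, so z stays away from 1; this bounds |z - w| below and hence |A| above.
  have h1 : 1 / (2 * (1 - z.re)) ≤ ((1 - z)⁻¹).re := by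
    rw [inv_re']
    simp only [sub_re, one_re, sub_im, one_im, zero_sub, neg_sq]
    rw [div_le_div_iff₀ (by positivity) hpos]
    nlinarith
  have h2 : ((1 - w)⁻¹).re ≤ 1 / 2 := by
    rw [inv_re']
    simp only [sub_re, one_re, sub_im, one_im, zero_sub, neg_sq]
    have : 1 ≤ w.re * w.re + w.im * w.im := by
      rw [← normSq_apply, normSq_eq_norm_sq]; nlinarith
    rw [div_le_div_iff₀ hpos' (by norm_num)]
    nlinarith
  have h3 : ‖(1 - z)⁻¹ - (1 - w)⁻¹‖ ≤ d := by
    have : (1 - z)⁻¹ - (1 - w)⁻¹ = A * (z - w) / (A * ((1 - z) * (1 - w))) := by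
      field_simp; ring
    rw [this, norm_div, ← hdd]
    exact div_le_self (norm_nonneg _) hv
  have h4 := (re_le_norm _).trans h3
  rw [sub_re] at h4
  have h5 : 1 ≤ (1 - z.re) * (1 + 2 * d) := by
    have : 1 / (2 * (1 - z.re)) ≤ 1 / 2 + d := by linarith
    rw [div_le_iff₀ (by positivity)] at this
    linarith
  have h6 : ‖z‖ ≤ 1 - (1 - z.re) / 2 := by
    refine le_of_sq_le_sq ?_ (by linarith)
    rw [← normSq_eq_norm_sq, normSq_apply]
    nlinarith
  have h7 : (1 - z.re) / 2 ≤ ‖z - w‖ := by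
    have := norm_sub_norm_le w z
    rw [norm_sub_rev] at this
    linarith
  have h8 : ‖A‖ * ((1 - z.re) / 2) ≤ d := by
    rw [hdd, norm_mul]; gcongr
  have hd0 : 0 ≤ d := norm_nonneg _
  nlinarith [norm_nonneg A]

theorem exists_unit_cone (z : ℂ) : ∃ u v : GaussianInt, (u : ℂ) * v = 1 ∧ ‖(u : ℂ)‖ = 1 ∧
    |((u : ℂ) * z).im| ≤ ((u : ℂ) * z).re ∧ (Diamond z → Diamond (u * z)) := by
  have hi : GaussianInt.toComplex ⟨0, 1⟩ = I := by apply Complex.ext <;> simp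
  have hi' : GaussianInt.toComplex ⟨0, -1⟩ = -I := by apply Complex.ext <;> simp
  by_cases h1 : 0 ≤ z.re + z.im <;> by_cases h2 : 0 ≤ z.re - z.im
  · refine ⟨1, 1, by simp, by simp, ?_, ?_⟩
    · simp [abs_le]; constructor <;> linarith
    · simp
  · refine ⟨⟨0, -1⟩, ⟨0, 1⟩, by simp [hi, hi'], by simp [hi'], ?_, ?_⟩
    · rw [hi']; simp [abs_le]; constructor <;> linarith
    · rw [hi']; simp only [Diamond, abs_le]; simp
      intros; refine ⟨⟨?_, ?_⟩, ?_, ?_⟩ <;> linarith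
  · refine ⟨⟨0, 1⟩, ⟨0, -1⟩, by simp [hi, hi'], by simp [hi], ?_, ?_⟩
    · rw [hi]; simp [abs_le]; constructor <;> linarith
    · rw [hi]; simp only [Diamond, abs_le]; simp
      intros; refine ⟨⟨?_, ?_⟩, ?_, ?_⟩ <;> linarith
  · refine ⟨-1, -1, by simp, by simp, ?_, ?_⟩
    · simp [abs_le]; constructor <;> linarith
    · simp only [Diamond, abs_le]; simp
      intros; refine ⟨⟨?_, ?_⟩, ?_, ?_⟩ <;> linarith

/-- A unit u rotates z into the cone around 1. Up to the unit u², A(1 - uz)(1 - uw) is the value of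
the quadratic at u⁻¹: a Gaussian integer, nonzero because the roots are irrational, hence of modulus
at least 1. -/
theorem QuadPair.norm_le {A B C : GaussianInt} {z w : ℂ} (h : QuadPair A B C z w)
    (hd : Diamond z) (hw : 1 ≤ ‖w‖) :
    ‖(A : ℂ)‖ ≤ 2 * ‖(A : ℂ) * (z - w)‖ * (1 + 2 * ‖(A : ℂ) * (z - w)‖) := by
  obtain ⟨u, v, huv, hu, hcone, hdu⟩ := exists_unit_cone z
  have key := norm_le_of_cone (A := A) (z := u * z) (w := u * w) (hdu hd) hcone
    (by rwa [norm_mul, hu, one_mul]) (by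
      have e : (A : ℂ) * ((1 - u * z) * (1 - u * w)) =
          u ^ 2 * ((A * v ^ 2 + B * v + C : GaussianInt) : ℂ) := by
        simp only [map_add, map_mul, map_pow]
        rw [h.root, ← huv]
        ring
      rw [e, norm_mul, norm_pow, hu, one_pow, one_mul]
      apply one_le_norm_coe
      intro h0
      have h0' := congrArg GaussianInt.toComplex h0
      simp only [map_add, map_mul, map_pow, map_zero] at h0'
      rw [h.root] at h0'
      rcases mul_eq_zero.1 ((mul_eq_zero.1 h0').resolve_left h.coe_ne_zero) with h1 | h1
      · exact one_ne_zero (h.irr 1 v (by rw [map_one]; linear_combination -h1))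
      · exact one_ne_zero (h.irr_right 1 v (by rw [map_one]; linear_combination -h1)))
  rw [← mul_sub, mul_left_comm, norm_mul (u : ℂ), hu, one_mul] at key
  exact key

/-- There are only finitely many reduced pairs of conjugates with a given discriminant. -/
theorem finite_quadPair (D : GaussianInt) :
    {p : ℂ × ℂ | (∃ A B C, QuadPair A B C p.1 p.2 ∧ B ^ 2 - 4 * A * C = D) ∧
      Diamond p.1 ∧ 1 ≤ ‖p.2‖}.Finite := by
  obtain ⟨δ, hδ⟩ := IsAlgClosed.exists_pow_nat_eq (D : ℂ) zero_lt_two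
  set d := ‖δ‖
  -- The quadratic formula recovers the pair from A, B and A(z - w) = ±δ; the bound on B comes from
  -- B = A(z - w) - 2Az with |z| ≤ 1.
  have hf := ((finite_norm_le (2 * d * (1 + 2 * d))).prod
    (finite_norm_le (d + 2 * (2 * d * (1 + 2 * d))))).prod (Set.toFinite {δ, -δ})
  refine (hf.image fun t : (GaussianInt × GaussianInt) × ℂ =>
    ((-(t.1.2 : ℂ) + t.2) / (2 * t.1.1), (-(t.1.2 : ℂ) - t.2) / (2 * t.1.1))).subset ?_
  rintro ⟨z, w⟩ ⟨⟨A, B, C, h, hD⟩, hd, hw⟩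
  have hA := h.coe_ne_zero
  have hsq := h.disc
  rw [hD, ← hδ, sq_eq_sq_iff_eq_or_eq_neg] at hsq
  have hnorm : ‖(A : ℂ) * (z - w)‖ = d := by
    rcases hsq with e | e <;> rw [e]
    exact norm_neg δ
  have hle := h.norm_le hd hw
  rw [hnorm] at hle
  refine ⟨((A, B), A * (z - w)), ⟨⟨hle, ?_⟩, hsq⟩, ?_⟩
  · have e : (B : ℂ) = A * (z - w) - 2 * (A * z) := by linear_combination h.sum
    change ‖(B : ℂ)‖ ≤ _
    rw [e]
    refine (norm_sub_le _ _).trans ?_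
    rw [hnorm, norm_mul, norm_mul, norm_ofNat]
    have := mul_le_mul hle hd.norm_le_one (norm_nonneg z) ((norm_nonneg _).trans hle)
    linarith
  · ext <;> simp only <;> rw [div_eq_iff (mul_ne_zero two_ne_zero hA)]
    · linear_combination -h.sum
    · linear_combination -h.sum

end JHurwitz

end

/-! ### Quadratic irrationals over ℚ(i) as roots of quadratics over ℤ[i]. -/

noncomputable section

namespace JHurwitz

open Complex
open Polynomial (C aeval)

theorem exists_mul_eq_of_mem_Qi {x : ℂ} (hx : x ∈ Qi) :
    ∃ p q : GaussianInt, q ≠ 0 ∧ x * q = p := by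
  induction hx using IntermediateField.adjoin_induction with
  | mem x hx =>
    obtain rfl : x = I := hx
    exact ⟨⟨0, 1⟩, 1, one_ne_zero, by apply Complex.ext <;> simp⟩
  | algebraMap r =>
    refine ⟨r.num, r.den, by exact_mod_cast r.den_nz, ?_⟩
    simp only [map_intCast, map_natCast, eq_ratCast]
    exact_mod_cast Rat.mul_den_eq_num r
  | add x y _ _ hx hy =>
    obtain ⟨p, q, hq, e⟩ := hx
    obtain ⟨p', q', hq', e'⟩ := hy
    exact ⟨p * q' + p' * q, q * q', mul_ne_zero hq hq', by
      simp only [map_add, map_mul]; rw [← e, ← e']; ring⟩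
  | inv x _ hx =>
    obtain ⟨p, q, hq, e⟩ := hx
    by_cases h : x = 0
    · exact ⟨0, 1, one_ne_zero, by simp [h]⟩
    · have hq' : (q : ℂ) ≠ 0 := by simpa using hq
      refine ⟨q, p, ?_, by rw [← e]; field_simp⟩
      have : (p : ℂ) ≠ 0 := by rw [← e]; exact mul_ne_zero h hq'
      simpa using this
  | mul x y _ _ hx hy =>
    obtain ⟨p, q, hq, e⟩ := hx
    obtain ⟨p', q', hq', e'⟩ := hy
    exact ⟨p * p', q * q', mul_ne_zero hq hq', by
      simp only [map_mul]; rw [← e, ← e']; ring⟩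

theorem coe_mem_Qi (g : GaussianInt) : (g : ℂ) ∈ Qi := by
  rw [GaussianInt.toComplex_def]
  exact add_mem (intCast_mem _ _) (mul_mem (intCast_mem _ _)
    (IntermediateField.mem_adjoin_simple_self ℚ I))

theorem Irr.notMem_Qi {z : ℂ} (h : Irr z) : z ∉ (algebraMap Qi ℂ).range := by
  rintro ⟨⟨x, hx⟩, rfl⟩
  obtain ⟨p, q, hq, e⟩ := exists_mul_eq_of_mem_Qi hx
  exact hq (h q p (by rw [mul_comm]; exact e))

theorem irr_of_notMem_Qi {z : ℂ} (h : z ∉ (algebraMap Qi ℂ).range) : Irr z := by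
  intro p q e
  by_contra hp
  have hp' : (p : ℂ) ≠ 0 := by simpa using hp
  refine h ⟨⟨z, ?_⟩, rfl⟩
  rw [show z = q / p by rw [← e]; field_simp]
  exact div_mem (coe_mem_Qi q) (coe_mem_Qi p)

/-- A pair of conjugates over `ℚ(i)` is the pair of roots of a quadratic polynomial over `ℤ[i]`. -/
theorem quadratic_iff_exists_quadPair {α β : ℂ} :
    IsQuadraticIrrational α ∧ IsGaloisConjugate α β ↔ ∃ A B C, QuadPair A B C α β := by
  constructor
  · rintro ⟨⟨halg, hdeg⟩, hne, hconj⟩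
    have hint : IsIntegral Qi α := halg.isIntegral
    have hmon := minpoly.monic hint
    have h1 := minpoly.aeval Qi α
    have h2 := hconj.aeval_eq_zero
    rw [Polynomial.aeval_eq_sum_range, hdeg] at h1 h2
    have hlead : (minpoly Qi α).coeff 2 = 1 := by
      have := hmon.coeff_natDegree; rwa [hdeg] at this
    simp only [Finset.sum_range_succ, Finset.sum_range_zero, hlead, Algebra.smul_def, pow_zero,
      pow_one, map_one, mul_one, one_mul, zero_add] at h1 h2
    obtain ⟨p, q, hq, e⟩ := exists_mul_eq_of_mem_Qi ((minpoly Qi α).coeff 1).2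
    obtain ⟨r, s, hs, e'⟩ := exists_mul_eq_of_mem_Qi ((minpoly Qi α).coeff 0).2
    change algebraMap Qi ℂ _ * _ = _ at e e'
    generalize algebraMap Qi ℂ ((minpoly Qi α).coeff 1) = b at *
    generalize algebraMap Qi ℂ ((minpoly Qi α).coeff 0) = c at *
    have hsum : α + β = -b := by
      -- Viète's relations from the two evaluations, using that the roots are distinct.
      have : (α - β) * (α + β + b) = 0 := by linear_combination h1 - h2
      linear_combination (mul_eq_zero.1 this).resolve_left (sub_ne_zero.2 hne.symm)
    have hprod : α * β = c := by linear_combination α * hsum - h1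
    refine ⟨q * s, p * s, r * q, mul_ne_zero hq hs, irr_of_notMem_Qi fun h => ?_, ?_, ?_⟩
    · rw [← minpoly.natDegree_eq_one_iff, hdeg] at h
      omega
    · rw [hsum, map_mul, map_mul, ← e]; ring
    · rw [hprod, map_mul, map_mul, ← e']; ring
  · rintro ⟨A, B, D, h⟩
    have hA := h.coe_ne_zero
    let b : Qi := ⟨B / A, div_mem (coe_mem_Qi B) (coe_mem_Qi A)⟩
    let c : Qi := ⟨D / A, div_mem (coe_mem_Qi D) (coe_mem_Qi A)⟩
    let f : Polynomial Qi :=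
      Polynomial.X ^ 2 + C b * Polynomial.X + C c
    have hf : f.Monic := by unfold f; monicity!
    have hfd : f.natDegree = 2 := by unfold f; compute_degree!
    have hroot : ∀ x, x = α ∨ x = β → aeval x f = 0 := by
      intro x hx
      have e := h.root x
      have e0 : (x - α) * (x - β) = 0 := by rcases hx with rfl | rfl <;> simp
      rw [e0, mul_zero] at e
      have e1 : algebraMap Qi ℂ b = B / A := rfl
      have e2 : algebraMap Qi ℂ c = D / A := rfl
      simp only [f, map_add, map_mul, map_pow, Polynomial.aeval_X, Polynomial.aeval_C, e1, e2]
      field_simp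
      linear_combination e
    have hint : IsIntegral Qi α := ⟨f, hf, hroot α (.inl rfl)⟩
    have h2 := (minpoly.two_le_natDegree_iff hint).2 h.irr.notMem_Qi
    have hdvd := minpoly.dvd Qi α (hroot α (.inl rfl))
    have heq : f = minpoly Qi α :=
      (Polynomial.eq_of_monic_of_dvd_of_natDegree_le (minpoly.monic hint) hf hdvd (by omega))
    refine ⟨⟨hint.isAlgebraic, by rw [← heq, hfd]⟩, h.ne.symm, ?_⟩
    exact isConjRoot_of_aeval_eq_zero hint (by rw [← heq]; exact hroot β (.inr rfl))

end JHurwitz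

end

/-! ### The domain X̃ in terms of the four discs centred at midpoints of edges. -/

noncomputable section

namespace JHurwitz

open Complex Filter Topology

theorem isCorner_I_pow (j : ℕ) : IsCorner (I ^ j * (1 - I)) := by
  rw [I_pow_eq_pow_mod]
  rcases I_pow_cases (Nat.mod_lt j (by norm_num)) with h | h | h | h <;> rw [h] <;>
    simp [IsCorner]

theorem IsCorner.exists_eq {c : ℂ} (h : IsCorner c) (j : ℕ) :
    ∃ k < 4, c = I ^ (k + j) * (1 - I) := by
  have key : ∃ i < 4, c = I ^ i * (1 - I) := by
    obtain ⟨hr | hr, hi | hi⟩ := h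
    · exact ⟨1, by norm_num, by apply Complex.ext <;> simp [hr, hi]⟩
    · exact ⟨0, by norm_num, by apply Complex.ext <;> simp [hr, hi]⟩
    · exact ⟨2, by norm_num, by apply Complex.ext <;> simp [hr, hi]⟩
    · exact ⟨3, by norm_num, by apply Complex.ext <;> simp [hr, hi, I_pow_three]⟩
  obtain ⟨i, hi, rfl⟩ := key
  refine ⟨(i + 3 * j) % 4, Nat.mod_lt _ (by norm_num), ?_⟩
  rw [I_pow_eq_pow_mod i, I_pow_eq_pow_mod ((i + 3 * j) % 4 + j)]
  congr 2
  omega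

theorem norm_sub_half_sq {c : ℂ} (hc : IsCorner c) (z : ℂ) :
    ‖z - c / 2‖ ^ 2 = z.re ^ 2 + z.im ^ 2 - (c.re * z.re + c.im * z.im) + 1 / 2 := by
  have hr : c.re ^ 2 = 1 := sq_eq_one_iff.2 hc.1
  have hi : c.im ^ 2 = 1 := sq_eq_one_iff.2 hc.2
  have e : c / 2 = ⟨c.re / 2, c.im / 2⟩ := by apply Complex.ext <;> simp
  rw [← normSq_eq_norm_sq, normSq_apply, e]
  simp only [sub_re, sub_im]
  linear_combination (hr + hi) / 4

theorem inDisc_iff {c : ℂ} (hc : IsCorner c) (z : ℂ) : InDisc c z ↔ ‖z - c / 2‖ < √2 / 2 := by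
  rw [← sq_lt_sq₀ (norm_nonneg _) (by positivity), norm_sub_half_sq hc, div_pow,
    Real.sq_sqrt (by norm_num), InDisc]
  constructor <;> intro h <;> linarith

theorem lt_norm_iff {c : ℂ} (hc : IsCorner c) (z : ℂ) :
    √2 / 2 < ‖z - c / 2‖ ↔ c.re * z.re + c.im * z.im < z.re ^ 2 + z.im ^ 2 := by
  rw [← sq_lt_sq₀ (by positivity) (norm_nonneg _), norm_sub_half_sq hc, div_pow,
    Real.sq_sqrt (by norm_num)]
  constructor <;> intro h <;> linarith

/-- Petals are indexed by rotations of 1 + i but their fibres by rotations of 1 - i; the index shift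
by one reconciles them. -/
theorem I_pow_mul_one_add (n : ℕ) : I ^ n * (1 + I) = I ^ (n + 1) * (1 - I) := by
  rw [pow_succ]; linear_combination I ^ n * I_sq

theorem I_pow_add_two (n : ℕ) : I ^ (n + 2) * (1 - I) = -(I ^ n * (1 - I)) := by
  rw [pow_add, I_sq]; ring

theorem I_pow_mul_one_sub_ne {k : ℕ} (hk : k ≤ 2) (j : ℕ) :
    I ^ (k + j + 1) * (1 - I) ≠ I ^ j * (1 - I) := by
  have h0 : (I ^ j * (1 - I) : ℂ) ≠ 0 := by
    intro h
    have := (isCorner_I_pow j).1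
    rw [h] at this; norm_num at this
  intro h
  have : (I ^ (k + 1) - 1 : ℂ) * (I ^ j * (1 - I)) = 0 := by
    rw [show k + j + 1 = (k + 1) + j by ring, pow_add] at h
    linear_combination h
  have := (mul_eq_zero.1 this).resolve_right h0
  interval_cases k <;> norm_num [Complex.ext_iff, I_pow_three, I_sq] at this

/-- The petal attached to the corner `c` lies outside the discs of the three other corners. -/
theorem mem_petalX_iff {j : ℕ} {z : ℂ} : z ∈ petalX j ↔ z ∈ X ∧
    ∀ c, IsCorner c → c ≠ I ^ j * (1 - I) → c.re * z.re + c.im * z.im < z.re ^ 2 + z.im ^ 2 := by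
  refine and_congr_right fun _ => ⟨fun h c hc hne => ?_, fun h k hk => ?_⟩
  · obtain ⟨k, hk, rfl⟩ := hc.exists_eq j
    rcases k with - | k
    · simp at hne
    · have := h k (by omega)
      rw [I_pow_mul_one_add] at this
      rw [show k + 1 + j = k + j + 1 by ring] at hc ⊢
      exact (lt_norm_iff hc z).1 this
  · rw [I_pow_mul_one_add]
    exact (lt_norm_iff (isCorner_I_pow _) z).2
      (h _ (isCorner_I_pow _) (I_pow_mul_one_sub_ne hk j))

theorem eq_of_mem_closure_petalX {j : ℕ} {z c : ℂ} (h : z ∈ closure (petalX j))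
    (hc : IsCorner c) (hin : InDisc c z) : c = I ^ j * (1 - I) := by
  by_contra hne
  have hcl : IsClosed {z : ℂ | c.re * z.re + c.im * z.im ≤ z.re ^ 2 + z.im ^ 2} :=
    isClosed_le (by fun_prop) (by fun_prop)
  have : z.re ^ 2 + z.im ^ 2 ≥ _ :=
    closure_minimal (fun y hy => ((mem_petalX_iff.1 hy).2 c hc hne).le) hcl h
  exact absurd hin (not_lt.2 this)

/-- Moving `z` towards the midpoint `c/2` of an edge and contracting increases the power with
respect to the circle of a different corner `c'`. -/
theorem lt_of_move {z c c' : ℂ} {t x y : ℝ} (hc : IsCorner c) (hc' : IsCorner c') (hne : c' ≠ c)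
    (h0 : c'.re * z.re + c'.im * z.im ≤ z.re ^ 2 + z.im ^ 2) (ht0 : 0 < t) (ht1 : t < 1)
    (htε : t < c.re * z.re + c.im * z.im - (z.re ^ 2 + z.im ^ 2))
    (hx : x = (1 - t) * z.re + t / 2 * c.re) (hy : y = (1 - t) * z.im + t / 2 * c.im)
    (hn1 : x ^ 2 + y ^ 2 ≤ 1) :
    c'.re * ((1 - t ^ 2) * x) + c'.im * ((1 - t ^ 2) * y) <
      ((1 - t ^ 2) * x) ^ 2 + ((1 - t ^ 2) * y) ^ 2 := by
  have hr : c.re ^ 2 = 1 := sq_eq_one_iff.2 hc.1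
  have hi : c.im ^ 2 = 1 := sq_eq_one_iff.2 hc.2
  have hcc : c'.re * c.re + c'.im * c.im ≤ 0 := by
    obtain ⟨h1 | h1, h2 | h2⟩ := hc <;> obtain ⟨h3 | h3, h4 | h4⟩ := hc' <;>
      rw [h1, h2, h3, h4] <;> norm_num <;>
      exact absurd (Complex.ext (h3.trans h1.symm) (h4.trans h2.symm)) hne
  have hε1 : c.re * z.re + c.im * z.im - (z.re ^ 2 + z.im ^ 2) ≤ 1 / 2 := by
    have := norm_sub_half_sq hc z
    nlinarith [sq_nonneg ‖z - c / 2‖]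
  obtain ⟨ε, hε⟩ : ∃ ε, ε = c.re * z.re + c.im * z.im - (z.re ^ 2 + z.im ^ 2) := ⟨_, rfl⟩
  rw [← hε] at htε hε1
  -- The power is quadratic with leading part |z|², so along the segment to c/2 it is the linear
  -- interpolation minus t(1 - t)|z - c/2|², where |z - c/2|² = 1/2 - ε.
  have hpow : x ^ 2 + y ^ 2 - (c'.re * x + c'.im * y) =
      (1 - t) * (z.re ^ 2 + z.im ^ 2 - (c'.re * z.re + c'.im * z.im))
      + t * (1 / 2 - (c'.re * c.re + c'.im * c.im) / 2)
      - t * (1 - t) * (1 / 2 - ε) := by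
    rw [hx, hy, hε]
    linear_combination (t ^ 2 / 4) * (hr + hi)
  have hpow' : t * ε + t ^ 2 * (1 / 2 - ε) ≤ x ^ 2 + y ^ 2 - (c'.re * x + c'.im * y) := by
    rw [hpow]
    have h5 := mul_nonneg (sub_nonneg.2 ht1.le) (sub_nonneg.2 h0)
    have h6 := mul_nonneg ht0.le (neg_nonneg.2 hcc)
    linarith
  have h1 : t ^ 2 < t * ε := by rw [sq]; exact mul_lt_mul_of_pos_left htε ht0
  have h2 : 0 ≤ t ^ 2 * (1 / 2 - ε) := mul_nonneg (sq_nonneg t) (by linarith)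
  have h3 : t ^ 2 * (x ^ 2 + y ^ 2) ≤ t ^ 2 := mul_le_of_le_one_right (sq_nonneg t) hn1
  -- Contraction by 1 - t² costs at most t² in the bracket, less than the gain tε.
  have h4 : 0 < (1 - t ^ 2) *
      (x ^ 2 + y ^ 2 - (c'.re * x + c'.im * y) - t ^ 2 * (x ^ 2 + y ^ 2)) :=
    mul_pos (by nlinarith) (by linarith)
  linarith

theorem abs_move_le {p q t : ℝ} (hp : |p| ≤ 1) (hq : |q| ≤ 2) (ht0 : 0 < t) (ht1 : t < 1) :
    |(1 - t) * p + t / 2 * q| ≤ 1 := by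
  rw [abs_le] at *
  constructor <;> nlinarith

/-- The closed petals are the closed conditions: move a point towards the midpoint of the outer
edge, which increases its power with respect to the three other circles, then contract. -/
theorem mem_closure_petalX {j : ℕ} {z : ℂ} (hd : Diamond z) (hin : InDisc (I ^ j * (1 - I)) z)
    (hout : ∀ c, IsCorner c → c ≠ I ^ j * (1 - I) →
      c.re * z.re + c.im * z.im ≤ z.re ^ 2 + z.im ^ 2) : z ∈ closure (petalX j) := by
  have hcj := isCorner_I_pow j
  have hmem := fun y : ℂ => mem_petalX_iff (j := j) (z := y)
  generalize I ^ j * (1 - I) = c at *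
  set ε := c.re * z.re + c.im * z.im - (z.re ^ 2 + z.im ^ 2) with hε
  have hε0 : 0 < ε := sub_pos.2 hin
  -- The contraction brings the point inside the half-open square; being of second order in t, it
  -- does not spoil the first-order gain from moving towards c/2.
  let f : ℝ → ℂ := fun t =>
    ((1 - t ^ 2 : ℝ) : ℂ) * (((1 - t : ℝ) : ℂ) * z + ((t / 2 : ℝ) : ℂ) * c)
  have hre : ∀ t, (f t).re = (1 - t ^ 2) * ((1 - t) * z.re + t / 2 * c.re) := fun t => by
    simp only [f, re_ofReal_mul, add_re]
  have him : ∀ t, (f t).im = (1 - t ^ 2) * ((1 - t) * z.im + t / 2 * c.im) := fun t => by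
    simp only [f, im_ofReal_mul, add_im]
  have hcont : Continuous f := by fun_prop
  have hf0 : f 0 = z := by simp [f]
  have htend : Tendsto f (𝓝[>] 0) (𝓝 z) := by
    have := hcont.tendsto 0
    rw [hf0] at this
    exact this.mono_left nhdsWithin_le_nhds
  refine mem_closure_of_tendsto htend ?_
  have hsmall : ∀ᶠ t : ℝ in 𝓝[>] 0, t ∈ Set.Ioo 0 (min 1 ε) :=
    Ioo_mem_nhdsGT (lt_min one_pos hε0)
  filter_upwards [hsmall] with t ⟨ht0, ht⟩
  obtain ⟨ht1, htε⟩ := lt_min_iff.1 ht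
  rw [hmem]
  have hlam : 0 < 1 - t ^ 2 := by nlinarith
  have hlam1 : 1 - t ^ 2 < 1 := by linarith [pow_pos ht0 2]
  obtain ⟨x, hx⟩ : ∃ x, x = (1 - t) * z.re + t / 2 * c.re := ⟨_, rfl⟩
  obtain ⟨y, hy⟩ : ∃ y, y = (1 - t) * z.im + t / 2 * c.im := ⟨_, rfl⟩
  obtain ⟨hd1, hd2⟩ := hd
  have hxy1 : |x + y| ≤ 1 := by
    have : |c.re + c.im| ≤ 2 := by
      obtain ⟨h1 | h1, h2 | h2⟩ := hcj <;> rw [h1, h2] <;> norm_num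
    rw [hx, hy]
    convert abs_move_le hd1 this ht0 ht1 using 2; ring
  have hxy2 : |x - y| ≤ 1 := by
    have : |c.re - c.im| ≤ 2 := by
      obtain ⟨h1 | h1, h2 | h2⟩ := hcj <;> rw [h1, h2] <;> norm_num
    rw [hx, hy]
    convert abs_move_le hd2 this ht0 ht1 using 2; ring
  have hcontract : ∀ s : ℝ, |s| ≤ 1 → -1 ≤ (1 - t ^ 2) * s ∧ (1 - t ^ 2) * s < 1 := by
    intro s hs
    rw [abs_le] at hs
    constructor <;> nlinarith
  constructor
  · rw [mem_X, hre, him, ← hx, ← hy, ← mul_add, ← mul_sub]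
    exact ⟨hcontract _ hxy1, hcontract _ hxy2⟩
  · intro c' hc' hne
    rw [hre, him, ← hx, ← hy]
    refine lt_of_move hcj hc' hne (hout c' hc' hne) ht0 ht1 htε hx hy ?_
    rw [abs_le] at hxy1 hxy2
    nlinarith

/-- The discs of opposite corners are tangent at 0. -/
theorem InDisc.not_neg {c z : ℂ} (h : InDisc c z) : ¬ InDisc (-c) z := by
  intro h'
  rw [InDisc, neg_re, neg_im] at h'
  rw [InDisc] at h
  nlinarith [sq_nonneg z.re, sq_nonneg z.im]

theorem mem_lensX_iff {j : ℕ} {z : ℂ} : z ∈ lensX j ↔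
    z ∈ X ∧ InDisc (I ^ j * (1 - I)) z ∧ InDisc (I ^ (j + 1) * (1 - I)) z := by
  refine and_congr_right fun _ => ⟨fun h => ⟨?_, ?_⟩, fun h k hk => ?_⟩
  · simpa [inDisc_iff (isCorner_I_pow j)] using h 0 (by norm_num)
  · simpa [inDisc_iff (isCorner_I_pow (j + 1)), add_comm] using h 1 le_rfl
  · rw [← inDisc_iff (isCorner_I_pow _)]
    interval_cases k
    · simpa using h.1
    · rw [add_comm]; exact h.2

/-- Each disc lies strictly between the two edge lines tangent to it, so the overlap of two adjacent
discs avoids all edges. Hence using the half-open square for the lenses loses no point. -/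
theorem mem_X_of_inDisc {z : ℂ} (hd : Diamond z) {j : ℕ} (h1 : InDisc (I ^ j * (1 - I)) z)
    (h2 : InDisc (I ^ (j + 1) * (1 - I)) z) : z ∈ X := by
  obtain ⟨hd1, hd2⟩ := hd
  rw [abs_le] at hd1 hd2
  rw [mem_X]
  rw [pow_succ] at h2
  rw [I_pow_eq_pow_mod] at h1 h2
  rcases I_pow_cases (Nat.mod_lt j (by norm_num)) with h | h | h | h <;> rw [h] at h1 h2 <;>
    simp [InDisc] at h1 h2 <;> refine ⟨⟨?_, ?_⟩, ?_, ?_⟩ <;>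
    nlinarith [sq_nonneg (z.re + z.im - 1), sq_nonneg (z.re - z.im - 1),
      sq_nonneg (z.re + z.im + 1), sq_nonneg (z.re - z.im + 1)]

theorem exists_inDisc {z : ℂ} (hd : Diamond z) (h0 : z ≠ 0) (h1 : ‖z‖ < 1) :
    ∃ j < 4, InDisc (I ^ j * (1 - I)) z := by
  have hpos := sq_add_sq_pos h0
  have hlt : z.re ^ 2 + z.im ^ 2 < 1 := by
    have : ‖z‖ ^ 2 < 1 := by nlinarith [norm_nonneg z]
    rwa [← normSq_eq_norm_sq, normSq_apply, ← sq, ← sq] at this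
  have key : ∃ c, IsCorner c ∧ c.re * z.re = |z.re| ∧ c.im * z.im = |z.im| := by
    rcases le_total 0 z.re with h | h <;> rcases le_total 0 z.im with h' | h'
    · exact ⟨⟨1, 1⟩, by simp [IsCorner], by simp [abs_of_nonneg h], by simp [abs_of_nonneg h']⟩
    · exact ⟨⟨1, -1⟩, by simp [IsCorner], by simp [abs_of_nonneg h], by simp [abs_of_nonpos h']⟩
    · exact ⟨⟨-1, 1⟩, by simp [IsCorner], by simp [abs_of_nonpos h], by simp [abs_of_nonneg h']⟩
    · exact ⟨⟨-1, -1⟩, by simp [IsCorner], by simp [abs_of_nonpos h], by simp [abs_of_nonpos h']⟩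
  obtain ⟨c, hc, hr, hi⟩ := key
  obtain ⟨j, hj, rfl⟩ := hc.exists_eq 0
  refine ⟨j, hj, ?_⟩
  rw [add_zero] at hr hi hc
  have hle := hd.le_one hc
  rw [InDisc]
  rw [hr, hi] at hle ⊢
  rw [← sq_abs z.re, ← sq_abs z.im] at hpos hlt ⊢
  have hx := abs_nonneg z.re
  have hy := abs_nonneg z.im
  generalize |z.re| = x at *
  generalize |z.im| = y at *
  have hxy : 0 ≤ x * y := mul_nonneg hx hy
  -- With x, y ≥ 0 and x + y ≤ 1, failure of the disc condition forces x + y = 0 or x² + y² ≥ 1: the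
  -- origin or a vertex, both excluded.
  by_contra! hge
  have hs : x + y ≤ (x + y) ^ 2 := by nlinarith
  rcases hle.lt_or_eq with h | h
  · have : x + y ≤ 0 := by nlinarith
    nlinarith
  · linarith

/-- Membership of a finite point in the domain `X̃`, in terms of the four discs. -/
theorem mem_Xtilde_iff {z w : ℂ} (hd : Diamond z) (h0 : z ≠ 0) (h1 : ‖z‖ < 1) :
    (z, (w : OnePoint ℂ)) ∈ Xtilde ↔
      1 < ‖w‖ ∧ ∀ c, IsCorner c → InDisc c z → 1 ≤ ‖w - c‖ := by
  have hw : ∀ W : Set ℂ, (w : OnePoint ℂ) ∈ withInfty W ↔ w ∈ W := by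
    intro W; simp [withInfty]
  simp only [Xtilde, Set.mem_union, Set.mem_iUnion, Set.mem_prod, hw, Finset.mem_range,
    exists_prop]
  constructor
  · rintro (⟨j, hj, hz, hw1, hw2⟩ | ⟨j, hj, hz, hw1, hw2⟩)
    · refine ⟨hw1, fun c hc hin => ?_⟩
      rw [eq_of_mem_closure_petalX hz hc hin]
      exact hw2
    · refine ⟨hw1, fun c hc hin => ?_⟩
      obtain ⟨hX, hz1, hz2⟩ := mem_lensX_iff.1 hz
      obtain ⟨k, hk, rfl⟩ := hc.exists_eq j
      interval_cases k
      · exact hw2 0 (by norm_num)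
      · exact hw2 1 le_rfl
      · rw [add_comm 2 j, I_pow_add_two] at hin
        exact absurd hin hz1.not_neg
      · rw [show 3 + j = j + 1 + 2 by ring, I_pow_add_two] at hin
        exact absurd hin hz2.not_neg
  · rintro ⟨hw1, hw2⟩
    -- Opposite discs are disjoint, so z is either in two adjacent discs (a lens) or in exactly one
    -- (a closed petal).
    by_cases hl : ∃ j < 4, InDisc (I ^ j * (1 - I)) z ∧ InDisc (I ^ (j + 1) * (1 - I)) z
    · obtain ⟨j, hj, h2, h3⟩ := hl
      refine .inr ⟨j, hj, mem_lensX_iff.2 ⟨mem_X_of_inDisc hd h2 h3, h2, h3⟩, hw1,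
        fun k hk => hw2 _ (isCorner_I_pow _) ?_⟩
      interval_cases k
      · simpa using h2
      · rwa [add_comm]
    · obtain ⟨j, hj, hin⟩ := exists_inDisc hd h0 h1
      refine .inl ⟨j, hj, mem_closure_petalX hd hin fun c hc hne => ?_, hw1,
        hw2 _ (isCorner_I_pow j) hin⟩
      by_contra! hlt
      have hlt : InDisc c z := hlt
      obtain ⟨k, hk, rfl⟩ := hc.exists_eq j
      interval_cases k
      · simp at hne
      · exact hl ⟨j, hj, hin, by rwa [add_comm 1 j] at hlt⟩
      · rw [add_comm 2 j, I_pow_add_two] at hlt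
        exact hin.not_neg hlt
      -- The second corner cyclically precedes j, so the lens carries its index j + 3 mod 4.
      · refine hl ⟨(3 + j) % 4, Nat.mod_lt _ (by norm_num), ?_, ?_⟩
        · rwa [← I_pow_eq_pow_mod]
        · rw [pow_succ, ← I_pow_eq_pow_mod, ← pow_succ, show 3 + j + 1 = 4 + j by ring, pow_add,
            I_pow_four, one_mul]
          exact hin

end JHurwitz

end

/-! ### Dynamics: periodicity on reduced pairs, and convergence of the orbit of ∞. -/

noncomputable section

namespace JHurwitz

open Complex Filter Topology
open scoped ComplexConjugate

theorem exists_digit_eq {z : ℂ} (h : z⁻¹ ∉ gaussInt) : ∃ a : GaussianInt, digit z = a := by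
  obtain ⟨m, l, e⟩ := (isFloor_digit h).even
  exact ⟨⟨m + l, m - l⟩, by rw [e]; apply Complex.ext <;> simp⟩

theorem Diamond.norm_lt_one {z : ℂ} (hd : Diamond z) (h : z⁻¹ ∉ gaussInt) : ‖z‖ < 1 :=
  hd.norm_le_one.lt_of_ne fun h1 => h (hd.inv_mem_gaussInt h1)

theorem Diamond.TH {z : ℂ} (hz : z ≠ 0) (h : z⁻¹ ∉ gaussInt) : Diamond (TH z) := by
  rw [TH_eq hz]
  exact (isFloor_digit h).diamond

theorem fiber_inv_iff {z w : ℂ} (hw : w ≠ 0) :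
    Fiber z w⁻¹ ↔ 1 ≤ ‖w‖ ∧ ∀ c, IsCorner c → InDisc c z → 1 ≤ ‖w - c‖ := by
  refine and_congr ?_ (forall₃_congr fun c hc _ => norm_inv_sub_conj hw hc)
  rw [norm_inv, inv_le_one₀ (norm_pos_iff.2 hw)]

/-- The natural extension of `T_H`. -/
def natExt (p : ℂ × ℂ) : ℂ × ℂ := (TH p.1, p.2⁻¹ - digit p.1)

/-- The pairs of conjugates of discriminant `D` in the closed natural-extension domain. -/
def reducedPairs (D : GaussianInt) : Set (ℂ × ℂ) :=
  {p | (∃ A B C, QuadPair A B C p.1 p.2 ∧ B ^ 2 - 4 * A * C = D) ∧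
    Diamond p.1 ∧ Fiber p.1 p.2⁻¹}

theorem finite_reducedPairs (D : GaussianInt) : (reducedPairs D).Finite := by
  refine (finite_quadPair D).subset ?_
  rintro p ⟨⟨A, B, C, h, e⟩, hd, hf⟩
  exact ⟨⟨A, B, C, h, e⟩, hd, ((fiber_inv_iff h.irr_right.ne_zero).1 hf).1⟩

theorem mapsTo_natExt (D : GaussianInt) :
    Set.MapsTo natExt (reducedPairs D) (reducedPairs D) := by
  rintro ⟨z, w⟩ ⟨⟨A, B, C, h, e⟩, hd, hf⟩
  have hz := h.irr.ne_zero
  have hi := h.irr.inv_notMem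
  obtain ⟨a, ha⟩ := exists_digit_eq hi
  refine ⟨⟨_, _, _, ?_, (QuadPair.disc_step A B C a).trans e⟩, Diamond.TH hz hi,
    (hf.step hz hd hi).2⟩
  have := h.step a
  rwa [← ha, ← TH_eq hz] at this

/-- Recovering the digit needs |1/w| < 1 strictly; a conjugate on the unit circle would put z there
as well. -/
theorem injOn_natExt (D : GaussianInt) : Set.InjOn natExt (reducedPairs D) := by
  rintro ⟨z, w⟩ ⟨⟨A, B, C, h, -⟩, hd, hf⟩ ⟨z', w'⟩ ⟨⟨A', B', C', h', -⟩, hd', hf'⟩ e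
  have hz := h.irr.ne_zero
  have hi := h.irr.inv_notMem
  have hz' := h'.irr.ne_zero
  have hi' := h'.irr.inv_notMem
  have e1 : TH z = TH z' := congrArg Prod.fst e
  have e2 : w⁻¹ - digit z = w'⁻¹ - digit z' := congrArg Prod.snd e
  have hw : ‖w⁻¹‖ < 1 := hf.1.lt_of_ne fun h1 => (hd.norm_lt_one hi).ne
    (h.norm_eq_one (by rwa [norm_inv, inv_eq_one] at h1))
  have hw' : ‖w'⁻¹‖ < 1 := hf'.1.lt_of_ne fun h1 => (hd'.norm_lt_one hi').ne
    (h'.norm_eq_one (by rwa [norm_inv, inv_eq_one] at h1))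
  have hdig := digit_eq_of_step_eq hz hz' hi hi' hf hf' hw hw' e1 e2
  rw [TH_eq hz, TH_eq hz', hdig, sub_left_inj, inv_inj] at e1
  rw [hdig, sub_left_inj, inv_inj] at e2
  exact Prod.ext e1 e2

theorem natExt_iterate_fst (p : ℂ × ℂ) (n : ℕ) : (natExt^[n] p).1 = TH^[n] p.1 :=
  Function.Semiconj.iterate_right (f := Prod.fst) (ga := natExt) (gb := TH) (fun _ => rfl) n p

/-- Every point is periodic under an injective self-map of a finite set. -/
theorem purelyPeriodic_of_mem_reducedPairs {D : GaussianInt} {p : ℂ × ℂ}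
    (hp : p ∈ reducedPairs D) : PurelyPeriodic p.1 := by
  have hmaps := mapsTo_natExt D
  constructor
  · intro n
    obtain ⟨⟨A, B, C, h, -⟩, -⟩ := hmaps.iterate n hp
    rw [← natExt_iterate_fst]
    exact h.irr.ne_zero
  · have : Finite (reducedPairs D) := (finite_reducedPairs D).to_subtype
    have hinj : Function.Injective (hmaps.restrict) :=
      (Set.MapsTo.restrict_inj hmaps).2 (injOn_natExt D)
    obtain ⟨m, hm, hper⟩ := hinj.mem_periodicPts ⟨p, hp⟩
    refine ⟨m, hm, fun n => ?_⟩
    rw [Function.iterate_add_apply]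
    congr 1
    rw [← natExt_iterate_fst]
    have := congrArg Subtype.val hper.eq
    rw [Set.MapsTo.iterate_restrict] at this
    exact congrArg Prod.fst this

/-- An infinite orbit together with its partial quotients. -/
structure Orbit (z : ℕ → ℂ) (a : ℕ → GaussianInt) : Prop where
  ne_zero : ∀ n, z n ≠ 0
  notMem : ∀ n, (z n)⁻¹ ∉ gaussInt
  diamond : ∀ n, Diamond (z n)
  succ : ∀ n, z (n + 1) = TH (z n)
  digit : ∀ n, digit (z n) = a n

theorem exists_orbit {α : ℂ} (hd : Diamond α) (h : ∀ n : ℕ, TH^[n] α ≠ 0) :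
    ∃ a, Orbit (fun n => TH^[n] α) a := by
  have hi : ∀ n, (TH^[n] α)⁻¹ ∉ gaussInt := fun n => by
    refine (inv_notMem_gaussInt_of_TH_ne_zero ?_).2
    rw [← Function.iterate_succ_apply' TH]
    exact h _
  choose a ha using fun n => exists_digit_eq (hi n)
  refine ⟨a, h, hi, fun n => ?_, fun n => Function.iterate_succ_apply' TH n α, ha⟩
  induction n with
  | zero => exact hd
  | succ n ih =>
    rw [Function.iterate_succ_apply']
    exact Diamond.TH (h n) (hi n)

namespace Orbit

variable {z : ℕ → ℂ} {a : ℕ → GaussianInt}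

theorem succ_eq (h : Orbit z a) (n : ℕ) : z (n + 1) = (z n)⁻¹ - a n := by
  rw [h.succ, TH_eq (h.ne_zero n), h.digit]

theorem norm_lt_one (h : Orbit z a) (n : ℕ) : ‖z n‖ < 1 := (h.diamond n).norm_lt_one (h.notMem n)

/-- Elements of `ℚ(i)` have terminating orbits, since the denominators decrease. -/
theorem irr (h : Orbit z a) (n : ℕ) : Irr (z n) := by
  intro p q e
  induction hN : p.norm.natAbs using Nat.strong_induction_on generalizing n p q with
  | _ N ih =>
    by_contra hp
    have hp' : (p : ℂ) ≠ 0 := by simpa using hp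
    have hq' : (q : ℂ) ≠ 0 := by rw [← e]; exact mul_ne_zero hp' (h.ne_zero n)
    have hlt : q.norm < p.norm := by
      have : ((q.norm : ℤ) : ℝ) < (p.norm : ℤ) := by
        rw [GaussianInt.intCast_real_norm, GaussianInt.intCast_real_norm, normSq_eq_norm_sq,
          normSq_eq_norm_sq, ← e, norm_mul]
        have h1 := h.norm_lt_one n
        have h2 := norm_pos_iff.2 hp'
        have h3 : ‖(p : ℂ)‖ * ‖z n‖ < ‖(p : ℂ)‖ := mul_lt_of_lt_one_right h2 h1
        gcongr
      exact_mod_cast this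
    have h0 := GaussianInt.norm_nonneg q
    have hq0 := ih q.norm.natAbs (by omega) (n + 1) q (p - a n * q) (by
      rw [h.succ_eq, map_sub, map_mul, ← e]
      have := h.ne_zero n
      field_simp) rfl
    exact hq' (by rw [hq0, map_zero])

/-- The Möbius map carrying z 0 to z n, normalised so that its denominator is the product of the
earlier terms, which has modulus less than 1 once n > 0. -/
theorem exists_matrix (h : Orbit z a) (n : ℕ) : ∃ p q r s : GaussianInt,
    p * z 0 + q = (∏ i ∈ Finset.range n, z i) * z n ∧
    r * z 0 + s = ∏ i ∈ Finset.range n, z i := by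
  induction n with
  | zero => exact ⟨1, 0, 0, 1, by simp, by simp⟩
  | succ n ih =>
    obtain ⟨p, q, r, s, h1, h2⟩ := ih
    refine ⟨r - a n * p, s - a n * q, p, q, ?_, ?_⟩
    · rw [Finset.prod_range_succ, h.succ_eq]
      have := h.ne_zero n
      simp only [map_sub, map_mul]
      rw [mul_sub, mul_assoc, mul_inv_cancel₀ this]
      linear_combination h2 - (a n : ℂ) * h1
    · rw [h1, Finset.prod_range_succ]

theorem norm_prod_lt_one (h : Orbit z a) {n : ℕ} (hn : 0 < n) :
    ‖∏ i ∈ Finset.range n, z i‖ < 1 := by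
  obtain ⟨k, rfl⟩ := Nat.exists_eq_succ_of_ne_zero hn.ne'
  rw [Finset.prod_range_succ, norm_mul]
  have : ‖∏ i ∈ Finset.range k, z i‖ ≤ 1 := by
    rw [norm_prod]
    exact Finset.prod_le_one (fun _ _ => norm_nonneg _) fun i _ => (h.norm_lt_one i).le
  exact mul_lt_one_of_nonneg_of_lt_one_right this (norm_nonneg _) (h.norm_lt_one k)

theorem exists_quadPair (h : Orbit z a) {m : ℕ} (hm : 0 < m) (hper : z m = z 0) :
    ∃ A B C w, QuadPair A B C (z 0) w := by
  obtain ⟨p, q, r, s, h1, h2⟩ := h.exists_matrix m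
  -- If r = 0, that product would be a nonzero Gaussian integer.
  have hr : r ≠ 0 := by
    rintro rfl
    rw [map_zero, zero_mul, zero_add] at h2
    have hs : s ≠ 0 := by
      rintro rfl
      rw [map_zero] at h2
      exact Finset.prod_ne_zero_iff.2 (fun i _ => h.ne_zero i) h2.symm
    have h3 := one_le_norm_coe hs
    rw [h2] at h3
    exact absurd (h.norm_prod_lt_one hm) (not_lt.2 h3)
  have hr' : (r : ℂ) ≠ 0 := by simpa using hr
  rw [hper, ← h2] at h1
  refine ⟨r, s - p, -q, -(s - p) / r - z 0, hr, h.irr 0, ?_, ?_⟩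
  · simp only [map_sub]
    field_simp
    ring
  · simp only [map_neg]
    field_simp
    linear_combination h1

/-- The orbit of the conjugate. -/
def conjOrbit (a : ℕ → GaussianInt) (w : ℂ) : ℕ → ℂ
  | 0 => w
  | n + 1 => (conjOrbit a w n)⁻¹ - a n

/-- The orbit of `∞` under the second component of the natural extension, in the coordinate
`1/w`. -/
def inftyOrbit (a : ℕ → GaussianInt) : ℕ → ℂ
  | 0 => 0
  | n + 1 => (inftyOrbit a n - a n)⁻¹

/-- The start ω = 0, i.e. w = ∞, lies in every fibre because corners have modulus greater than 1;
invariance does the rest. -/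
theorem fiber_inftyOrbit (h : Orbit z a) (n : ℕ) : Fiber (z n) (inftyOrbit a n) := by
  induction n with
  | zero =>
    refine ⟨by simp [inftyOrbit], fun c hc _ => ?_⟩
    rw [inftyOrbit, zero_sub, norm_neg, norm_conj]
    obtain ⟨m, l, e⟩ := hc.coord
    have := abs_re_le_norm c
    rcases hc.1 with h1 | h1 <;> rw [h1] at this <;> simpa using this
  | succ n ih =>
    rw [h.succ, inftyOrbit, ← h.digit]
    exact (ih.step (h.ne_zero n) (h.diamond n) (h.notMem n)).2

theorem inftyOrbit_sub_ne_zero (h : Orbit z a) (n : ℕ) : inftyOrbit a n - a n ≠ 0 := by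
  have := ((h.fiber_inftyOrbit n).step (h.ne_zero n) (h.diamond n) (h.notMem n)).1
  intro h0
  rw [h.digit, h0, norm_zero] at this
  linarith

variable {A B C : GaussianInt} {w : ℂ}

/-- Each step multiplies the leading coefficient by the product of the current roots. Being a
nonzero Gaussian integer, it bounds the product of the conjugates from below. -/
theorem exists_quadPair_conjOrbit (h : Orbit z a) (hq : QuadPair A B C (z 0) w) (n : ℕ) :
    ∃ A' B' C', QuadPair A' B' C' (z n) (conjOrbit a w n) ∧
      (A' : ℂ) = A * ((∏ i ∈ Finset.range n, z i) * ∏ i ∈ Finset.range n, conjOrbit a w i) := by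
  induction n with
  | zero => exact ⟨A, B, C, hq, by simp⟩
  | succ n ih =>
    obtain ⟨A', B', C', h1, h2⟩ := ih
    refine ⟨_, _, _, by rw [h.succ_eq]; exact h1.step (a n), ?_⟩
    rw [← h1.prod, h2, Finset.prod_range_succ, Finset.prod_range_succ]
    ring

/-- A closed form for the orbit of ∞, cleared of denominators, to be compared with the orbit of the
conjugate. -/
theorem inftyOrbit_mul (h : Orbit z a) (hq : QuadPair A B C (z 0) w) (n : ℕ) :
    inftyOrbit a n * ((∏ i ∈ Finset.range n, conjOrbit a w i) * conjOrbit a w n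
      - (∏ i ∈ Finset.range n, z i) * z n) =
    (∏ i ∈ Finset.range n, conjOrbit a w i) - ∏ i ∈ Finset.range n, z i := by
  induction n with
  | zero => simp [inftyOrbit]
  | succ n ih =>
    obtain ⟨_, _, _, h1, -⟩ := h.exists_quadPair_conjOrbit hq n
    have hw := h1.irr_right.ne_zero
    have hz := h.ne_zero n
    have h0 := h.inftyOrbit_sub_ne_zero n
    rw [Finset.prod_range_succ, Finset.prod_range_succ, h.succ_eq, inftyOrbit,
      show conjOrbit a w (n + 1) = (conjOrbit a w n)⁻¹ - a n from rfl, inv_mul_eq_iff_eq_mul₀ h0]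
    generalize conjOrbit a w n = w' at *
    have e1 : ∀ v : ℂ, v * w' * (w'⁻¹ - a n) = v - a n * (v * w') := fun v => by field_simp
    have e2 : ∀ v : ℂ, v * z n * ((z n)⁻¹ - a n) = v - a n * (v * z n) := fun v => by field_simp
    rw [e1, e2]
    linear_combination -ih

theorem prod_range_mul (m : ℕ) (hper : ∀ n, z (n + m) = z n) (k : ℕ) :
    ∏ i ∈ Finset.range (m * k), z i = (∏ i ∈ Finset.range m, z i) ^ k := by
  induction k with
  | zero => simp
  | succ k ih =>
    rw [Nat.mul_succ, add_comm, Finset.prod_range_add, pow_succ', ← ih]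
    simp only [add_comm m, hper]

/-- The orbit of `∞` converges, along multiples of the period, to the conjugate. -/
theorem tendsto_inftyOrbit (h : Orbit z a) (hq : QuadPair A B C (z 0) w) {m : ℕ} (hm : 0 < m)
    (hper : ∀ n, z (n + m) = z n) :
    Tendsto (fun k => inftyOrbit a (m * k)) atTop (𝓝 w⁻¹) := by
  have hw := hq.irr_right.ne_zero
  have hzk : ∀ k, z (m * k) = z 0 := fun k => by
    induction k with
    | zero => rfl
    | succ k ih => rw [Nat.mul_succ, hper, ih]
  set lam := ∏ i ∈ Finset.range m, z i with hlam
  have hlt : ‖lam‖ ^ 2 < 1 := by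
    have := h.norm_prod_lt_one hm
    nlinarith [norm_nonneg lam]
  have hbound : ∀ k, ‖inftyOrbit a (m * k) - w⁻¹‖ ≤
      (2 * ‖(A : ℂ)‖ * ‖w⁻¹‖) * (‖lam‖ ^ 2) ^ k := by
    intro k
    obtain ⟨A', B', C', h1, h2⟩ := h.exists_quadPair_conjOrbit hq (m * k)
    have h3 := h.inftyOrbit_mul hq (m * k)
    have hom := (h.fiber_inftyOrbit (m * k)).1
    rw [hzk] at h1 h3
    -- After whole periods z returns to z 0, and a conjugate is determined by its partner, so w
    -- returns too.
    rw [← hq.right_unique h1, prod_range_mul m hper, ← hlam] at h3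
    rw [prod_range_mul m hper, ← hlam] at h2
    have hz := (h.norm_lt_one 0).le
    have hA := one_le_norm_coe h1.ne_zero
    rw [h2, norm_mul, norm_mul] at hA
    generalize inftyOrbit a (m * k) = ω at *
    generalize ∏ i ∈ Finset.range (m * k), conjOrbit a w i = v at *
    have hv : v ≠ 0 := by rintro rfl; norm_num at hA
    have e : v * (ω - w⁻¹) = lam ^ k * w⁻¹ * (ω * z 0 - 1) := by
      field_simp
      linear_combination h3
    have e' := congrArg norm e
    rw [norm_mul, norm_mul, norm_mul] at e'
    have hb : ‖ω * z 0 - 1‖ ≤ 2 := by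
      refine (norm_sub_le _ _).trans ?_
      rw [norm_mul, norm_one]
      nlinarith [norm_nonneg ω, norm_nonneg (z 0)]
    have hs : (‖lam‖ ^ 2) ^ k = ‖lam ^ k‖ * ‖lam ^ k‖ := by rw [norm_pow]; ring
    rw [hs]
    have hvp := norm_pos_iff.2 hv
    -- By `e'`, |v| times the error is of order |lam|^k; integrality gives |A| |lam|^k |v| ≥ 1,
    -- which supplies a second factor |lam|^k.
    calc ‖ω - w⁻¹‖ ≤ (‖(A : ℂ)‖ * (‖lam ^ k‖ * ‖v‖)) * ‖ω - w⁻¹‖ :=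
          le_mul_of_one_le_left (norm_nonneg _) hA
      _ = ‖(A : ℂ)‖ * ‖lam ^ k‖ * (‖v‖ * ‖ω - w⁻¹‖) := by ring
      _ = ‖(A : ℂ)‖ * ‖lam ^ k‖ * (‖lam ^ k‖ * ‖w⁻¹‖ * ‖ω * z 0 - 1‖) := by rw [e']
      _ ≤ ‖(A : ℂ)‖ * ‖lam ^ k‖ * (‖lam ^ k‖ * ‖w⁻¹‖ * 2) := by gcongr
      _ = _ := by ring
  rw [tendsto_iff_norm_sub_tendsto_zero]
  refine squeeze_zero (fun _ => norm_nonneg _) hbound ?_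
  simpa using (tendsto_pow_atTop_nhds_zero_of_lt_one (by positivity) hlt).const_mul
    (2 * ‖(A : ℂ)‖ * ‖w⁻¹‖)

/-- Over the fixed point z 0 the fibre conditions on ω are closed, so they pass to the limit. -/
theorem fiber_inv (h : Orbit z a) (hq : QuadPair A B C (z 0) w) {m : ℕ} (hm : 0 < m)
    (hper : ∀ n, z (n + m) = z n) : Fiber (z 0) w⁻¹ := by
  have ht := h.tendsto_inftyOrbit hq hm hper
  have hzk : ∀ k, z (m * k) = z 0 := fun k => by
    induction k with
    | zero => rfl
    | succ k ih => rw [Nat.mul_succ, hper, ih]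
  have hf := fun k => h.fiber_inftyOrbit (m * k)
  simp only [hzk] at hf
  exact ⟨le_of_tendsto' ht.norm fun k => (hf k).1, fun c hc hin =>
    ge_of_tendsto' (ht.sub_const (conj c)).norm fun k => (hf k).2 c hc hin⟩

end Orbit

end JHurwitz

end

theorem theorem6p1 (α : ℂ) (hα : α ∈ closure JHurwitz.X) :
    JHurwitz.PurelyPeriodic α ↔
      JHurwitz.IsQuadraticIrrational α ∧
        ∃ α' : ℂ, JHurwitz.IsGaloisConjugate α α' ∧
          (α, (α' : OnePoint ℂ)) ∈ JHurwitz.Xtilde := by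
  have hd := JHurwitz.mem_closure_X.1 hα
  constructor
  · rintro ⟨hne, m, hm, hper⟩
    obtain ⟨a, ho⟩ := JHurwitz.exists_orbit hd hne
    obtain ⟨A, B, C, w, hq⟩ := ho.exists_quadPair hm (by simpa using hper 0)
    have hf := ho.fiber_inv hq hm hper
    have hq : JHurwitz.QuadPair A B C α w := hq
    have hf : JHurwitz.Fiber α w⁻¹ := hf
    have hlt := hd.norm_lt_one hq.irr.inv_notMem
    obtain ⟨h1, h2⟩ := JHurwitz.quadratic_iff_exists_quadPair.2 ⟨A, B, C, hq⟩
    obtain ⟨h3, h4⟩ := (JHurwitz.fiber_inv_iff hq.irr_right.ne_zero).1 hf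
    refine ⟨h1, w, h2, (JHurwitz.mem_Xtilde_iff hd hq.irr.ne_zero hlt).2 ⟨?_, h4⟩⟩
    -- The limit only gives |w| ≥ 1; equality would force |α| = 1.
    exact h3.lt_of_ne fun h => hlt.ne (hq.norm_eq_one h.symm)
  · rintro ⟨h1, w, h2, h3⟩
    obtain ⟨A, B, C, hq⟩ := JHurwitz.quadratic_iff_exists_quadPair.1 ⟨h1, h2⟩
    have hlt := hd.norm_lt_one hq.irr.inv_notMem
    obtain ⟨h4, h5⟩ := (JHurwitz.mem_Xtilde_iff hd hq.irr.ne_zero hlt).1 h3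
    exact JHurwitz.purelyPeriodic_of_mem_reducedPairs (p := (α, w)) ⟨⟨A, B, C, hq, rfl⟩, hd,
      (JHurwitz.fiber_inv_iff hq.irr_right.ne_zero).2 ⟨h4.le, h5⟩⟩
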